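/- All Banach spaces are complex, and $L^2(\mathbb R_+)=L^2(\mathbb R_+;\mathbb C)$. For a bounded operator $R:L^2(\mathbb R_+)\to E$ put $$\|R\|_{\gamma_\infty}:=\sup\Bigl(\mathbb E\Bigl\|\sum_{n=1}^N\gamma_nRh_n\Bigr\|^2\Bigr)^{1/2},$$ where $\gamma_1,\gamma_2,\dots$ are independent standard real Gaussian random variables and the supremum is over all $N$ and all orthonormal systems $h_1,\dots,h_N$ in $L^2(\mathbb R_+)$; $R$ is almost summing if $\|R\|_{\gamma_\infty}<\infty$. A strongly measurable function $\phi:\mathbb R_+\to E$ belongs to $\gamma_\infty(\mathbb R_+,E)$ if $\langle\phi,x^*\rangle\in L^2(\mathbb R_+)$ for all $x^*\in E^*$ and the Pettis integral operator $R_\phi f=\int_0^\infty f(t)\phi(t)\,dt$ is a bounded almost summing operator; then $\|\phi\|_{\gamma_\infty}:=\|R_\phi\|_{\gamma_\infty}$. A set $\mathscr T$ of bounded operators $F\to E$ is $R$-bounded if there is $K\ge0$ with $\mathbb E\|\sum_{n=1}^N r_nT_nx_n\|^2\le K^2\,\mathbb E\|\sum_{n=1}^N r_nx_n\|^2$ for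 all $N$, $T_n\in\mathscr T$, $x_n\in F$, where $r_1,r_2,\dots$ are independent Rademacher (random sign) variables; the least such $K$ is denoted $\mathscr R(\mathscr T)$. For a closed operator $A$ on $E$ with spectrum $\sigma(A)$, resolvent set $\varrho(A)$ and resolvent $R(\lambda,A)=(\lambda-A)^{-1}$, let $s(A)=\sup\{\operatorname{Re}\lambda:\lambda\in\sigma(A)\}\in[-\infty,\infty]$, and let $s_R(A)\in[-\infty,\infty]$ be the infimum of all $\omega\in\mathbb R$ such that $\{\operatorname{Re}\lambda>\omega\}\subseteq\varrho(A)$ and $\{R(\lambda,A):\operatorname{Re}\lambda>\omega\}$ is $R$-bounded. **Theorem.** There is a universal constant $C>0$ with the following two properties. 1. Let $E,F$ be Banach spaces, let $\Theta:F\to\mathcal B(L^2(\mathbb R_+),E)$ be bounded and linear, and let $K\ge0$ be such that $\|\Theta y\|_{\gamma_\infty}\le K\|y\|$ for all $y\in F$. For $\operatorname{Re}\lambda>0$ let $\widehat\Theta(\lambda)y:=(\Theta y)e_\lambda$, where $e_\lambda(t)=e^{-\lambda t}$. Then for every $\delta>0$ the set $\{\widehat\Theta(\lambda):\operatorname{Re}\lambda\ge\delta\}$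 is $R$-bounded, with $\mathscr R(\{\widehat\Theta(\lambda):\operatorname{Re}\lambda\ge\delta\})\le KC/\sqrt\delta$. 2. Let $A$ be the generator of a strongly continuous semigroup $(T(t))_{t\ge0}$ on a Banach space $E$ such that $T(\cdot)x\in\gamma_\infty(\mathbb R_+,E)$ for all $x\in E$. Then: - $s_R(A)<0$; moreover, there is $\varepsilon>0$ such that $\{\operatorname{Re}\lambda\ge-\varepsilon\}\subseteq\varrho(A)$ and $\{R(\lambda,A):\operatorname{Re}\lambda\ge-\varepsilon\}$ is $R$-bounded; - there is $M\ge0$ such that $\|T(\cdot)x\|_{\gamma_\infty}\le M\|x\|$ for all $x\in E$, and for every such $M$, with $c:=CM$, one has $s(A)\le-\dfrac1{4c^2}$ (if $E=\{0\}$, then $\sigma(A)=\emptyset$ and $s(A)=-\infty$; otherwise $c>0$). -/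

import Mathlib

open Filter Topology MeasureTheory ProbabilityTheory
open scoped NNReal ENNReal

universe u v

noncomputable section

/-! ### Strongly continuous semigroups and their generators -/

/-- A strongly continuous semigroup `(T(t))_{t ≥ 0}` of bounded operators on `E`. -/
structure C0Semigroup (E : Type*) [NormedAddCommGroup E] [NormedSpace ℂ E] where
  /-- the operator `T(t)` -/
  op : ℝ≥0 → E →L[ℂ] E
  op_zero : op 0 = ContinuousLinearMap.id ℂ E
  op_add : ∀ s t : ℝ≥0, op (s + t) = (op s).comp (op t)
  continuous_orbit : ∀ x : E, Continuous fun t : ℝ≥0 => op t x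

namespace C0Semigroup

variable {E : Type*} [NormedAddCommGroup E] [NormedSpace ℂ E]

/-- The orbit `t ↦ T(t) x`. It is used only for `t ≥ 0`: below, `ℝ` carries Lebesgue
measure restricted to `[0, ∞)`. -/
def orbit (T : C0Semigroup E) (x : E) (t : ℝ) : E := T.op t.toNNReal x

/-- `y = lim_{t ↓ 0} (T(t) x - x) / t`. -/
def HasGenerator (T : C0Semigroup E) (x y : E) : Prop :=
  Tendsto (fun t : ℝ => ((t : ℂ)⁻¹) • (T.orbit x t - x)) (𝓝[>] 0) (𝓝 y)

theorem HasGenerator.add {T : C0Semigroup E} {x y x' y' : E}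
    (h : T.HasGenerator x y) (h' : T.HasGenerator x' y') :
    T.HasGenerator (x + x') (y + y') := by
  refine (Tendsto.add h h').congr fun t => ?_
  rw [← smul_add]
  congr 1
  simp only [orbit, map_add]
  abel

theorem HasGenerator.smul {T : C0Semigroup E} {x y : E} (c : ℂ)
    (h : T.HasGenerator x y) : T.HasGenerator (c • x) (c • y) := by
  refine (Tendsto.const_smul h c).congr fun t => ?_
  simp only [orbit, map_smul, ← smul_sub]
  rw [smul_comm]

theorem HasGenerator.unique {T : C0Semigroup E} {x y y' : E}
    (h : T.HasGenerator x y) (h' : T.HasGenerator x y') : y = y' :=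
  tendsto_nhds_unique h h'

/-- The generator `A` of the semigroup: `A x = lim_{t ↓ 0} (T(t) x - x) / t`, with domain
the set of all `x` for which this limit exists. -/
def generator (T : C0Semigroup E) : E →ₗ.[ℂ] E where
  domain :=
    { carrier := {x | ∃ y, T.HasGenerator x y}
      add_mem' := fun ⟨_, h⟩ ⟨_, h'⟩ => ⟨_, h.add h'⟩
      zero_mem' := ⟨0, by simp [HasGenerator, orbit]⟩
      smul_mem' := fun c _ ⟨_, h⟩ => ⟨_, h.smul c⟩ }
  toFun :=
    { toFun := fun x => Classical.choose x.2
      map_add' := fun x y => HasGenerator.unique (Classical.choose_spec (x + y).2)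
        ((Classical.choose_spec x.2).add (Classical.choose_spec y.2))
      map_smul' := fun c x => HasGenerator.unique (Classical.choose_spec (c • x).2)
        ((Classical.choose_spec x.2).smul c) }

theorem generator_spec (T : C0Semigroup E) (x : T.generator.domain) :
    T.HasGenerator (x : E) (T.generator x) :=
  Classical.choose_spec x.2

end C0Semigroup

/-! ### Spectrum and resolvent of an unbounded operator -/

section Resolvent

variable {E : Type*} [NormedAddCommGroup E] [NormedSpace ℂ E]

/-- The bounded operator `R` is the two-sided inverse of `z - A : D(A) → E`. -/
def IsResolventAt (A : E →ₗ.[ℂ] E) (z : ℂ) (R : E →L[ℂ] E) : Prop :=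
  (∀ x : E, ∃ h : R x ∈ A.domain, z • R x - A ⟨R x, h⟩ = x) ∧
    ∀ x : A.domain, R (z • (x : E) - A x) = x

theorem IsResolventAt.unique {A : E →ₗ.[ℂ] E} {z : ℂ} {R R' : E →L[ℂ] E}
    (h : IsResolventAt A z R) (h' : IsResolventAt A z R') : R = R' := by
  ext x
  obtain ⟨hx, e⟩ := h.1 x
  have := h'.2 ⟨R x, hx⟩
  simp only [e] at this
  exact this.symm

/-- The resolvent set `ϱ(A)`. -/
def pmapResolventSet (A : E →ₗ.[ℂ] E) : Set ℂ := {z | ∃ R, IsResolventAt A z R}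

/-- The spectrum `σ(A) = ℂ ∖ ϱ(A)`. -/
def pmapSpectrum (A : E →ₗ.[ℂ] E) : Set ℂ := (pmapResolventSet A)ᶜ

open scoped Classical in
/-- The resolvent `R(z, A) = (z - A)⁻¹` for `z ∈ ϱ(A)` (and `0` for other `z`). -/
def pmapResolvent (A : E →ₗ.[ℂ] E) (z : ℂ) : E →L[ℂ] E :=
  if h : z ∈ pmapResolventSet A then Classical.choose h else 0

theorem pmapResolvent_spec {A : E →ₗ.[ℂ] E} {z : ℂ} (h : z ∈ pmapResolventSet A) :
    IsResolventAt A z (pmapResolvent A z) := by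
  rw [pmapResolvent, dif_pos h]
  exact Classical.choose_spec h

/-- The spectral bound `s(A) = sup {Re z : z ∈ σ(A)}`, with value `-∞` if `σ(A) = ∅`. -/
def spectralBound (A : E →ₗ.[ℂ] E) : EReal :=
  ⨆ z ∈ pmapSpectrum A, ((z.re : ℝ) : EReal)

end Resolvent

/-! ### R-boundedness -/

section RBounded

variable {E F : Type*} [NormedAddCommGroup E] [NormedSpace ℂ E]
  [NormedAddCommGroup F] [NormedSpace ℂ F]

/-- `𝔼 ‖∑ₙ rₙ xₙ‖²` for independent Rademacher variables `r₁, …, r_N`: the vector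
`(r₁, …, r_N)` is uniformly distributed on the `2 ^ N` elements of `{-1, 1}^N`. -/
def rademacherSq {N : ℕ} (x : Fin N → E) : ℝ :=
  (∑ r : Fin N → ℤˣ, ‖∑ n, ((r n : ℤˣ) : ℤ) • x n‖ ^ 2) / 2 ^ N

/-- The family `𝒯` is R-bounded, with R-bound at most `C`. -/
def IsRBoundedWith (𝒯 : Set (F →L[ℂ] E)) (C : ℝ) : Prop :=
  0 ≤ C ∧ ∀ (N : ℕ) (S : Fin N → F →L[ℂ] E) (x : Fin N → F), (∀ n, S n ∈ 𝒯) →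
    rademacherSq (fun n => S n (x n)) ≤ C ^ 2 * rademacherSq x

/-- The family `𝒯` is R-bounded. -/
def IsRBounded (𝒯 : Set (F →L[ℂ] E)) : Prop := ∃ C : ℝ, IsRBoundedWith 𝒯 C

/-- The abscissa of R-boundedness of the resolvent: the infimum `s_R(A)` of all `ω ∈ ℝ` such
that `{Re z > ω} ⊆ ϱ(A)` and `{R(z, A) : Re z > ω}` is R-bounded. -/
def rBoundednessAbscissa (A : E →ₗ.[ℂ] E) : EReal :=
  ⨅ ω ∈ {ω : ℝ | {z : ℂ | ω < z.re} ⊆ pmapResolventSet A ∧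
    IsRBounded (pmapResolvent A '' {z : ℂ | ω < z.re})}, (ω : EReal)

end RBounded

/-! ### Almost summing operators -/

section AlmostSumming

variable {E : Type*} [NormedAddCommGroup E] [NormedSpace ℂ E]

/-- The norm `sup ‖∑ₙ γₙ R hₙ‖_{L²(Ω, E)}` of `γ_∞(H, E)`, over all finite orthonormal systems
`h₁, …, h_N` in `H`, where `γ₁, …, γ_N` are independent standard (real) Gaussian random variables,
realized as the coordinates of `ℝ^N` with the product Gaussian measure. The value is `∞` if `R`
is not almost summing. -/
def almostSummingNorm {H : Type*} [NormedAddCommGroup H] [InnerProductSpace ℂ H]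
    (R : H →L[ℂ] E) : ℝ≥0∞ :=
  ⨆ (N : ℕ) (h : Fin N → H) (_ : Orthonormal ℂ h),
    eLpNorm (fun γ : Fin N → ℝ => ∑ n, (γ n : ℂ) • R (h n)) 2
      (Measure.pi fun _ : Fin N => gaussianReal 0 1)

/-- Lebesgue measure on `ℝ₊ = [0, ∞)`. -/
def halfLine : Measure ℝ := volume.restrict (Set.Ici 0)

/-- `R` is the Pettis integral operator `R_φ f = ∫_{ℝ₊} f(t) φ(t) dt` from `L²(ℝ₊)` to `E`. -/
def IsPettisOperator (φ : ℝ → E) (R : Lp ℂ 2 halfLine →L[ℂ] E) : Prop :=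
  ∀ (f : Lp ℂ 2 halfLine) (ψ : E →L[ℂ] ℂ), ψ (R f) = ∫ t, f t * ψ (φ t) ∂halfLine

theorem IsPettisOperator.unique {φ : ℝ → E} {R R' : Lp ℂ 2 halfLine →L[ℂ] E}
    (h : IsPettisOperator φ R) (h' : IsPettisOperator φ R') : R = R' := by
  ext f
  exact (SeparatingDual.eq_iff_forall_dual_eq (R := ℂ)).2 fun ψ => (h f ψ).trans (h' f ψ).symm

/-- `‖φ‖_{γ_∞(ℝ₊, E)} = ‖R_φ‖_{γ_∞(L²(ℝ₊), E)}`; the infimum is over the at most one operator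
`R_φ`, and the value is `∞` if there is none. -/
def gammaInftyNorm (φ : ℝ → E) : ℝ≥0∞ :=
  ⨅ (R : Lp ℂ 2 halfLine →L[ℂ] E) (_ : IsPettisOperator φ R), almostSummingNorm R

/-- `φ ∈ γ_∞(ℝ₊, E)`: `φ` is strongly measurable and weakly square integrable, and its Pettis
integral operator `R_φ` is almost summing. -/
def MemGammaInfty (φ : ℝ → E) : Prop :=
  AEStronglyMeasurable φ halfLine ∧
    (∀ ψ : E →L[ℂ] ℂ, MemLp (fun t => ψ (φ t)) 2 halfLine) ∧
    ∃ R : Lp ℂ 2 halfLine →L[ℂ] E, IsPettisOperator φ R ∧ almostSummingNorm R < ∞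

end AlmostSumming

/-! ### The Laplace transform -/

theorem memLp_exp_halfLine {z : ℂ} (hz : 0 < z.re) :
    MemLp (fun t : ℝ => Complex.exp (-z * t)) 2 halfLine := by
  have hc : Continuous fun t : ℝ => Complex.exp (-z * t) := by fun_prop
  rw [memLp_two_iff_integrable_sq_norm hc.aestronglyMeasurable]
  have h : Integrable (fun t : ℝ => Real.exp (-(2 * z.re) * t)) halfLine := by
    have := integrableOn_exp_mul_Ioi (a := -(2 * z.re)) (by linarith) 0
    exact (integrableOn_Ici_iff_integrableOn_Ioi).2 this
  refine h.congr (Eventually.of_forall fun t => ?_)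
  simp only [Complex.norm_exp]
  rw [← Real.exp_nat_mul]
  congr 1
  simp
  ring

/-- The element `e_z(t) = e^{-z t}` of `L²(ℝ₊)`, for `Re z > 0`. -/
def expL2 (z : ℂ) (hz : 0 < z.re) : Lp ℂ 2 halfLine := (memLp_exp_halfLine hz).toLp _

/-- The Laplace transform `Θ̂(z) y = (Θ y) e_z`, for `Re z > 0`. -/
def laplaceTransform {E F : Type*} [NormedAddCommGroup E] [NormedSpace ℂ E]
    [NormedAddCommGroup F] [NormedSpace ℂ F] (Θ : F →L[ℂ] (Lp ℂ 2 halfLine →L[ℂ] E))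
    (z : ℂ) (hz : 0 < z.re) : F →L[ℂ] E :=
  Θ.flip (expL2 z hz)

end

/-! Exponentials along a vertical lattice are nearly orthogonal in L²(ℝ₊). For ζ on a lattice of
step A with real part comparable to A, the Gram matrix of the e_ζ is a Cauchy kernel of norm O(1/A)
on ℓ² (`bessel_expL2`). A finite Bessel system with bound B is B times the average of two
orthonormal systems (`exists_orthonormal_dilation`), so the γ_∞-norm controls Gaussian sums over it,
and hence Rademacher sums. Applying this to the vectors ∑ rₙ yₙ for all signs r bounds a double
random sum, and extracting its diagonal gives R-boundedness on the lattice
(`norm_randomSum_bessel_le`).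

Cauchy's formula on circles around lattice points passes from lattices to the strip A ≤ Re z ≤ 2A
with bound O(K/√A) (`norm_randomSum_strip_le`). Dyadic strips then sum geometrically to O(K/√δ) on
Re z ≥ δ (`norm_randomSum_halfPlane_le`).

For a semigroup, the closed graph theorem makes x ↦ R_{T(·)x} a bounded operator Θ, the uniform
boundedness principle gives M, and the Laplace transform of Θ is the resolvent of the generator. So
the resolvent has R-bound at most c/√δ on Re z ≥ δ with c = CM. This growth is slower than the 1/δ
which spectrum on the imaginary axis would force. The resolvent identity moves the half-plane left
by any H < √δ/c (`isRBounded_pmapResolvent_extension`), and δ = 1/(4c²) is the choice that reaches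
furthest, up to -1/(4c²). -/

noncomputable section

/-! ### Random sums -/

section RandomSum

variable {ι κ : Type*} [Fintype ι] [Fintype κ]
  {E : Type*} [NormedAddCommGroup E] [NormedSpace ℂ E]

/-- The random sum `∑ₙ rₙ xₙ` as a vector in `ℓ²({-1, 1}^ι, E)`. -/
def randomSum : (ι → E) →L[ℂ] PiLp 2 (fun _ : ι → ℤˣ => E) :=
  (PiLp.continuousLinearEquiv 2 ℂ (fun _ : ι → ℤˣ => E)).symm.toContinuousLinearMap.comp
    (ContinuousLinearMap.pi fun r : ι → ℤˣ =>
      ∑ n, ((r n : ℤˣ) : ℤ) • ContinuousLinearMap.proj (R := ℂ) (φ := fun _ : ι => E) n)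

theorem randomSum_apply (x : ι → E) (r : ι → ℤˣ) :
    randomSum x r = ∑ n, ((r n : ℤˣ) : ℤ) • x n := by
  simp [randomSum]

variable [DecidableEq ι] [DecidableEq κ]

theorem norm_randomSum_sq (x : ι → E) :
    ‖randomSum x‖ ^ 2 = ∑ r : ι → ℤˣ, ‖∑ n, ((r n : ℤˣ) : ℤ) • x n‖ ^ 2 := by
  simp_rw [PiLp.norm_sq_eq_of_L2, randomSum_apply]

theorem rademacherSq_eq {N : ℕ} (x : Fin N → E) :
    rademacherSq x = ‖randomSum x‖ ^ 2 / 2 ^ N := by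
  rw [rademacherSq, norm_randomSum_sq]

/-- The normalisation 2^N cancels, so R-bounds become norm estimates for a linear map, to which the
triangle inequality and vector-valued integration apply. -/
theorem isRBoundedWith_iff {F : Type*} [NormedAddCommGroup F] [NormedSpace ℂ F]
    {𝒯 : Set (F →L[ℂ] E)} {C : ℝ} :
    IsRBoundedWith 𝒯 C ↔ 0 ≤ C ∧ ∀ (N : ℕ) (S : Fin N → F →L[ℂ] E) (x : Fin N → F),
      (∀ n, S n ∈ 𝒯) → ‖randomSum fun n => S n (x n)‖ ≤ C * ‖randomSum x‖ := by
  refine and_congr_right fun hC => forall_congr' fun N => forall_congr' fun S =>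
    forall_congr' fun x => imp_congr_right fun _ => ?_
  rw [rademacherSq_eq, rademacherSq_eq, ← mul_div_assoc, div_le_div_iff_of_pos_right (by positivity),
    ← mul_pow]
  exact sq_le_sq₀ (norm_nonneg _) (mul_nonneg hC (norm_nonneg _))

/-- Multiplication by a fixed sign pattern permutes the cube {-1, 1}^ι. -/
theorem norm_randomSum_signs (σ : ι → ℤˣ) (x : ι → E) :
    ‖randomSum fun n => ((σ n : ℤˣ) : ℤ) • x n‖ = ‖randomSum x‖ := by
  rw [← sq_eq_sq₀ (norm_nonneg _) (norm_nonneg _), norm_randomSum_sq, norm_randomSum_sq]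
  refine Fintype.sum_equiv (Equiv.mulRight σ) _ _ fun r => ?_
  simp [mul_smul]

/-- Scaling one coefficient by a real number in `[-1, 1]` does not increase the norm. -/
theorem norm_randomSum_update_le (x : ι → E) (i : ι) {a : ℝ} (ha : |a| ≤ 1) :
    ‖randomSum (Function.update x i ((a : ℂ) • x i))‖ ≤ ‖randomSum x‖ := by
  have h1 := abs_le.1 ha
  -- Since a is a convex combination of 1 and -1, the updated family is one of x and its sign flip
  -- at i, which have the same norm.
  have key : Function.update x i ((a : ℂ) • x i) = (((1 + a) / 2 : ℝ) : ℂ) • x +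
      (((1 - a) / 2 : ℝ) : ℂ) • fun n => ((Function.update (1 : ι → ℤˣ) i (-1) n : ℤˣ) : ℤ) • x n := by
    ext n
    by_cases h : n = i
    · subst h
      simp only [Function.update_self, Pi.add_apply, Pi.smul_apply]
      simp only [Units.val_neg, Units.val_one, neg_smul, one_smul, smul_neg, ← sub_eq_add_neg,
        ← sub_smul]
      congr 1
      push_cast
      ring
    · simp only [Function.update_of_ne h, Pi.add_apply, Pi.smul_apply, Pi.one_apply,
        Units.val_one, one_smul, ← add_smul]
      conv_lhs => rw [← one_smul ℂ (x n)]
      congr 1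
      push_cast
      ring
  rw [key, map_add, map_smul, map_smul]
  refine (norm_add_le _ _).trans ?_
  rw [norm_smul, norm_smul, norm_randomSum_signs, Complex.norm_real, Complex.norm_real,
    Real.norm_of_nonneg (by linarith), Real.norm_of_nonneg (by linarith), ← add_mul]
  apply le_of_eq
  ring

/-- The contraction principle with real coefficients. -/
theorem norm_randomSum_real_smul_le (x : ι → E) {a : ι → ℝ} (ha : ∀ n, |a n| ≤ 1) :
    ‖randomSum fun n => (a n : ℂ) • x n‖ ≤ ‖randomSum x‖ := by
  have key : ∀ s : Finset ι,
      ‖randomSum fun n => (if n ∈ s then (a n : ℂ) else 1) • x n‖ ≤ ‖randomSum x‖ := by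
    intro s
    induction s using Finset.induction_on with
    | empty => simp
    | insert i s hi ih =>
      refine le_trans (le_of_eq ?_) ((norm_randomSum_update_le _ i (ha i)).trans ih)
      congr 2
      ext n
      by_cases h : n = i
      · subst h
        simp [hi]
      · simp [h]
  simpa using key Finset.univ

/-- The contraction principle with complex coefficients. -/
theorem norm_randomSum_smul_le (x : ι → E) {a : ι → ℂ} {B : ℝ} (hB : 0 < B)
    (ha : ∀ n, ‖a n‖ ≤ B) :
    ‖randomSum fun n => a n • x n‖ ≤ 2 * B * ‖randomSum x‖ := by
  have hre : ∀ n, |(a n).re / B| ≤ 1 := fun n => by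
    rw [abs_div, abs_of_pos hB, div_le_one hB]
    exact (Complex.abs_re_le_norm _).trans (ha n)
  have him : ∀ n, |(a n).im / B| ≤ 1 := fun n => by
    rw [abs_div, abs_of_pos hB, div_le_one hB]
    exact (Complex.abs_im_le_norm _).trans (ha n)
  have key : (fun n => a n • x n) =
      (B : ℂ) • (fun n => (((a n).re / B : ℝ) : ℂ) • x n) +
      ((B : ℂ) * Complex.I) • (fun n => (((a n).im / B : ℝ) : ℂ) • x n) := by
    ext n
    have hB' : (B : ℂ) ≠ 0 := by exact_mod_cast hB.ne'
    simp only [Pi.add_apply, Pi.smul_apply, smul_smul, ← add_smul]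
    congr 1
    conv_lhs => rw [← Complex.re_add_im (a n)]
    push_cast
    field_simp
  rw [key, map_add, map_smul, map_smul]
  refine (norm_add_le _ _).trans ?_
  rw [norm_smul, norm_smul, norm_mul, Complex.norm_I, Complex.norm_real, Real.norm_of_nonneg hB.le,
    mul_one]
  have h1 := mul_le_mul_of_nonneg_left (norm_randomSum_real_smul_le x hre) hB.le
  have h2 := mul_le_mul_of_nonneg_left (norm_randomSum_real_smul_le x him) hB.le
  linarith

theorem norm_sum_sq_le_card {α G : Type*} [Fintype α] [SeminormedAddCommGroup G] (v : α → G) :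
    ‖∑ i, v i‖ ^ 2 ≤ Fintype.card α * ∑ i, ‖v i‖ ^ 2 := by
  calc ‖∑ i, v i‖ ^ 2 ≤ (∑ i, ‖v i‖) ^ 2 := by gcongr; exact norm_sum_le _ _
    _ ≤ _ := by simpa using sq_sum_le_card_mul_sum_sq (s := Finset.univ) (f := fun i => ‖v i‖)

/-- Orthogonality of Rademacher variables: for i ≠ j, flipping the sign at i changes the sign of the
whole sum. -/
theorem sum_signs_mul_eq (i j : κ) :
    ∑ ε : κ → ℤˣ, ((ε i * ε j : ℤˣ) : ℤ) = if i = j then (Fintype.card (κ → ℤˣ) : ℤ) else 0 := by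
  split_ifs with h
  · subst h
    simp
  · have h2 : ∑ ε : κ → ℤˣ, ((ε i * ε j : ℤˣ) : ℤ) = ∑ ε : κ → ℤˣ, -((ε i * ε j : ℤˣ) : ℤ) := by
      refine Fintype.sum_equiv (Equiv.mulRight (Function.update (1 : κ → ℤˣ) i (-1))) _ _
        fun ε => ?_
      simp [Function.update_of_ne (Ne.symm h)]
    rw [Finset.sum_neg_distrib] at h2
    omega

/-- Extraction of the diagonal `(k n, n)` from a double random sum. -/
theorem norm_randomSum_diagonal_le (k : ι → κ) (x : κ → ι → E) :
    Fintype.card (κ → ℤˣ) * ‖randomSum fun n => x (k n) n‖ ^ 2 ≤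
      ∑ ε : κ → ℤˣ, ‖randomSum fun n => ∑ j, ((ε j : ℤˣ) : ℤ) • x j n‖ ^ 2 := by
  set c : ℝ := (Fintype.card (κ → ℤˣ) : ℝ) with hc
  have hc0 : 0 < c := by
    rw [hc]
    exact Nat.cast_pos.2 Fintype.card_pos
  -- Averaging against ε (k n) selects j = k n. After Cauchy–Schwarz over ε, the factors ε (k n) are
  -- a fixed sign pattern in n and disappear from the norm.
  have key : (∑ ε : κ → ℤˣ, randomSum fun n =>
      ((ε (k n) : ℤˣ) : ℤ) • ∑ j, ((ε j : ℤˣ) : ℤ) • x j n) =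
      (c : ℂ) • randomSum fun n => x (k n) n := by
    rw [← map_sum, ← map_smul]
    congr 1
    ext n
    simp only [Finset.sum_apply, Finset.smul_sum, Pi.smul_apply]
    rw [Finset.sum_comm]
    have : ∀ j, ∑ ε : κ → ℤˣ, ((ε (k n) : ℤˣ) : ℤ) • ((ε j : ℤˣ) : ℤ) • x j n =
        (if k n = j then (Fintype.card (κ → ℤˣ) : ℤ) else 0) • x j n := fun j => by
      rw [← sum_signs_mul_eq, Finset.sum_smul]
      simp [mul_smul]
    simp_rw [this]
    simp only [ite_smul, zero_smul, Finset.sum_ite_eq, Finset.mem_univ, if_true, hc]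
    rw [← Int.cast_smul_eq_zsmul ℂ]
    simp
  have h := norm_sum_sq_le_card fun ε : κ → ℤˣ => randomSum fun n =>
      ((ε (k n) : ℤˣ) : ℤ) • ∑ j, ((ε j : ℤˣ) : ℤ) • x j n
  rw [key, norm_smul, mul_pow, Complex.norm_real, Real.norm_of_nonneg hc0.le] at h
  simp_rw [fun ε : κ → ℤˣ => norm_randomSum_signs (fun n => ε (k n))
    (fun n => ∑ j, ((ε j : ℤˣ) : ℤ) • x j n)] at h
  rw [← hc, pow_two c, mul_assoc] at h
  exact le_of_mul_le_mul_left h hc0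

end RandomSum

end

noncomputable section

/-! ### Gaussian sums -/

section GaussianSum

variable {E : Type*} [NormedAddCommGroup E] [NormedSpace ℂ E]

/-- The law of `N` independent standard Gaussian variables. -/
abbrev stdGaussianPi (N : ℕ) : Measure (Fin N → ℝ) := Measure.pi fun _ : Fin N => gaussianReal 0 1

/-- The first absolute moment `𝔼 |γ|` of a standard Gaussian variable. -/
def gaussianAbsMoment : ℝ := ∫ x, |x| ∂gaussianReal 0 1

theorem integrable_abs_gaussianReal : Integrable (fun x : ℝ => |x|) (gaussianReal 0 1) :=
  ((memLp_id_gaussianReal 1).integrable le_rfl).norm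

theorem gaussianAbsMoment_pos : 0 < gaussianAbsMoment := by
  rw [gaussianAbsMoment, integral_pos_iff_support_of_nonneg (fun x => abs_nonneg x)
    integrable_abs_gaussianReal]
  have h : Function.support (fun x : ℝ => |x|) = {0}ᶜ := by
    ext x
    simp
  have := nullSingletonClass_gaussianReal (μ := 0) (v := 1) one_ne_zero
  rw [h, prob_compl_eq_one_sub (measurableSet_singleton 0), measure_singleton]
  simp

theorem memLp_gaussianSum {N : ℕ} (v : Fin N → E) :
    MemLp (fun γ : Fin N → ℝ => ∑ n, (γ n : ℂ) • v n) 2 (stdGaussianPi N) := by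
  refine memLp_finsetSum _ fun n _ => ?_
  have h : MemLp (fun γ : Fin N → ℝ => γ n) 2 (stdGaussianPi N) :=
    (memLp_id_gaussianReal 2).comp_measurePreserving (measurePreserving_eval _ n)
  have h2 : MemLp (fun γ : Fin N → ℝ => (γ n : ℂ)) 2 (stdGaussianPi N) := h.ofReal
  refine MemLp.of_le_mul (c := ‖v n‖) h2 (h2.aestronglyMeasurable.smul_const _) ?_
  refine Eventually.of_forall fun γ => ?_
  rw [norm_smul, mul_comm]

theorem integrable_norm_gaussianSum_sq {N : ℕ} (v : Fin N → E) :
    Integrable (fun γ : Fin N → ℝ => ‖∑ n, (γ n : ℂ) • v n‖ ^ 2) (stdGaussianPi N) :=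
  (memLp_gaussianSum v).integrable_norm_pow two_ne_zero

theorem measurePreserving_signs {N : ℕ} (ε : Fin N → ℤˣ) :
    MeasurePreserving (fun (γ : Fin N → ℝ) n => (((ε n : ℤˣ) : ℤ) : ℝ) * γ n)
      (stdGaussianPi N) (stdGaussianPi N) := by
  refine measurePreserving_pi (fun _ => gaussianReal 0 1) (fun _ => gaussianReal 0 1)
    (f := fun n x => (((ε n : ℤˣ) : ℤ) : ℝ) * x) fun n => ?_
  refine ⟨by fun_prop, ?_⟩
  rcases Int.units_eq_one_or (ε n) with h | h
  · simp [h]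
  · have := gaussianReal_map_neg (μ := 0) (v := 1)
    simpa [h] using this

/-- Comparison of Rademacher sums with Gaussian sums. -/
theorem sum_signs_le_integral_gaussianSum [CompleteSpace E] {N : ℕ} (v : Fin N → E) :
    gaussianAbsMoment ^ 2 * ‖randomSum v‖ ^ 2 ≤
      2 ^ N * ∫ γ, ‖∑ n, (γ n : ℂ) • v n‖ ^ 2 ∂stdGaussianPi N := by
  have hflip : ∀ ε : Fin N → ℤˣ,
      ∫ γ, ‖∑ n, (γ n : ℂ) • (((ε n : ℤˣ) : ℤ) • v n)‖ ^ 2 ∂stdGaussianPi N =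
        ∫ γ, ‖∑ n, (γ n : ℂ) • v n‖ ^ 2 ∂stdGaussianPi N := fun ε => by
    have hm : MeasurableEmbedding fun (γ : Fin N → ℝ) n => (((ε n : ℤˣ) : ℤ) : ℝ) * γ n := by
      refine (measurePreserving_signs ε).measurable.measurableEmbedding fun γ γ' h => ?_
      ext n
      have := congrFun h n
      have h0 : (((ε n : ℤˣ) : ℤ) : ℝ) ≠ 0 := by exact_mod_cast (ε n).ne_zero
      exact mul_left_cancel₀ h0 this
    rw [← (measurePreserving_signs ε).integral_comp hm]
    refine integral_congr_ae (Eventually.of_forall fun γ => ?_)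
    simp only
    congr 2
    refine Finset.sum_congr rfl fun n _ => ?_
    rcases Int.units_eq_one_or (ε n) with h | h <;> simp [h]
  -- For fixed γ its signs are absorbed by relabelling ε, so γ may be replaced by |γ|, which has
  -- nonzero mean.
  have habs : ∀ γ : Fin N → ℝ,
      ∑ ε : Fin N → ℤˣ, ‖∑ n, (γ n : ℂ) • (((ε n : ℤˣ) : ℤ) • v n)‖ ^ 2 =
        ∑ ε : Fin N → ℤˣ, ‖∑ n, ((|γ n| : ℝ) : ℂ) • (((ε n : ℤˣ) : ℤ) • v n)‖ ^ 2 := fun γ => by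
    refine Fintype.sum_equiv (Equiv.mulRight fun n => if 0 ≤ γ n then 1 else -1) _ _ fun ε => ?_
    congr 2
    refine Finset.sum_congr rfl fun n _ => ?_
    by_cases h : 0 ≤ γ n
    · simp [h, abs_of_nonneg h]
    · simp [h, abs_of_neg (not_le.1 h)]
  have hint : ∀ ε : Fin N → ℤˣ, Integrable
      (fun γ : Fin N → ℝ => ‖∑ n, ((|γ n| : ℝ) : ℂ) • (((ε n : ℤˣ) : ℤ) • v n)‖ ^ 2)
      (stdGaussianPi N) := fun ε => by
    refine Integrable.mono'
      (integrable_finsetSum Finset.univ fun ε' (_ : ε' ∈ (Finset.univ : Finset (Fin N → ℤˣ))) =>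
        integrable_norm_gaussianSum_sq (fun n => (((ε' n : ℤˣ) : ℤ) • v n))) ?_ ?_
    · refine Continuous.aestronglyMeasurable ?_
      fun_prop
    · refine Eventually.of_forall fun γ => ?_
      rw [Real.norm_of_nonneg (by positivity), habs γ]
      exact Finset.single_le_sum
        (f := fun ε : Fin N → ℤˣ => ‖∑ n, ((|γ n| : ℝ) : ℂ) • (((ε n : ℤˣ) : ℤ) • v n)‖ ^ 2)
        (fun _ _ => by positivity) (Finset.mem_univ ε)
  -- Jensen's inequality in two steps: the norm of a mean is at most the mean of the norm, and a
  -- variance is nonnegative.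
  have hjensen : ∀ ε : Fin N → ℤˣ, gaussianAbsMoment ^ 2 * ‖∑ n, ((ε n : ℤˣ) : ℤ) • v n‖ ^ 2 ≤
      ∫ γ, ‖∑ n, ((|γ n| : ℝ) : ℂ) • (((ε n : ℤˣ) : ℤ) • v n)‖ ^ 2 ∂stdGaussianPi N := fun ε => by
    have hI : ∀ n, Integrable (fun γ : Fin N → ℝ => ((|γ n| : ℝ) : ℂ)) (stdGaussianPi N) :=
      fun n => ((measurePreserving_eval (fun _ : Fin N => gaussianReal 0 1) n).integrable_comp
        integrable_abs_gaussianReal.aestronglyMeasurable |>.2 integrable_abs_gaussianReal).ofReal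
    have hmean : ∀ n, ∫ γ, ((|γ n| : ℝ) : ℂ) ∂stdGaussianPi N = (gaussianAbsMoment : ℂ) := fun n => by
      rw [integral_complex_ofReal, gaussianAbsMoment]
      congr 1
      have := integral_map (μ := stdGaussianPi N) (φ := fun γ => γ n) (f := fun x : ℝ => |x|)
        (measurable_pi_apply n).aemeasurable (by fun_prop)
      rw [(measurePreserving_eval (fun _ : Fin N => gaussianReal 0 1) n).map_eq] at this
      exact this.symm
    have hsum : ∫ γ, ∑ n, ((|γ n| : ℝ) : ℂ) • (((ε n : ℤˣ) : ℤ) • v n) ∂stdGaussianPi N =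
        (gaussianAbsMoment : ℂ) • ∑ n, ((ε n : ℤˣ) : ℤ) • v n := by
      rw [integral_finsetSum _ fun n _ => (hI n).smul_const _, Finset.smul_sum]
      refine Finset.sum_congr rfl fun n _ => ?_
      rw [integral_smul_const, hmean]
    have hL : MemLp (fun γ : Fin N → ℝ => ‖∑ n, ((|γ n| : ℝ) : ℂ) • (((ε n : ℤˣ) : ℤ) • v n)‖) 2
        (stdGaussianPi N) := by
      rw [memLp_two_iff_integrable_sq]
      · exact hint ε
      · exact Continuous.aestronglyMeasurable (by fun_prop)
    have h1 : gaussianAbsMoment * ‖∑ n, ((ε n : ℤˣ) : ℤ) • v n‖ ≤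
        ∫ γ, ‖∑ n, ((|γ n| : ℝ) : ℂ) • (((ε n : ℤˣ) : ℤ) • v n)‖ ∂stdGaussianPi N := by
      refine le_trans (le_of_eq ?_) (norm_integral_le_integral_norm _)
      rw [hsum, norm_smul, Complex.norm_real, Real.norm_of_nonneg gaussianAbsMoment_pos.le]
    have h2 := ProbabilityTheory.variance_nonneg
      (fun γ : Fin N → ℝ => ‖∑ n, ((|γ n| : ℝ) : ℂ) • (((ε n : ℤˣ) : ℤ) • v n)‖) (stdGaussianPi N)
    rw [ProbabilityTheory.variance_eq_sub hL] at h2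
    rw [← mul_pow]
    have h3 : 0 ≤ gaussianAbsMoment * ‖∑ n, ((ε n : ℤˣ) : ℤ) • v n‖ :=
      mul_nonneg gaussianAbsMoment_pos.le (norm_nonneg _)
    refine (pow_le_pow_left₀ h3 h1 2).trans ?_
    simpa using h2
  rw [norm_randomSum_sq, Finset.mul_sum]
  calc _ ≤ ∑ ε : Fin N → ℤˣ,
        ∫ γ, ‖∑ n, ((|γ n| : ℝ) : ℂ) • (((ε n : ℤˣ) : ℤ) • v n)‖ ^ 2 ∂stdGaussianPi N :=
        Finset.sum_le_sum fun ε _ => hjensen ε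
    _ = ∑ ε : Fin N → ℤˣ,
        ∫ γ, ‖∑ n, (γ n : ℂ) • (((ε n : ℤˣ) : ℤ) • v n)‖ ^ 2 ∂stdGaussianPi N := by
        rw [← integral_finsetSum _ fun ε _ => hint ε,
          ← integral_finsetSum _ fun ε _ => integrable_norm_gaussianSum_sq _]
        exact integral_congr_ae (Eventually.of_forall fun γ => (habs γ).symm)
    _ = _ := by
        simp_rw [hflip]
        simp

theorem integral_gaussianSum_le_of_eLpNorm_le {N : ℕ} {v : Fin N → E} {B : ℝ} (hB : 0 ≤ B)
    (h : eLpNorm (fun γ : Fin N → ℝ => ∑ n, (γ n : ℂ) • v n) 2 (stdGaussianPi N) ≤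
      ENNReal.ofReal B) :
    ∫ γ, ‖∑ n, (γ n : ℂ) • v n‖ ^ 2 ∂stdGaussianPi N ≤ B ^ 2 := by
  rw [(memLp_gaussianSum v).eLpNorm_eq_integral_rpow_norm two_ne_zero ENNReal.ofNat_ne_top,
    ENNReal.ofReal_le_ofReal_iff hB] at h
  have h0 : 0 ≤ ∫ γ, ‖∑ n, (γ n : ℂ) • v n‖ ^ 2 ∂stdGaussianPi N :=
    integral_nonneg fun γ => by positivity
  simp only [ENNReal.toReal_ofNat, Real.rpow_ofNat] at h
  rw [← one_div, ← Real.sqrt_eq_rpow] at h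
  exact (Real.sqrt_le_left hB).1 h

end GaussianSum

end

noncomputable section

/-! ### Dilation of Bessel systems to orthonormal systems -/

section Dilation

open scoped InnerProductSpace Matrix MatrixOrder ComplexOrder

variable {H : Type*} [NormedAddCommGroup H] [InnerProductSpace ℂ H]

/-- H = V ⊕ Vᗮ with V finite-dimensional, so Vᗮ is infinite-dimensional and Gram–Schmidt applies
there. This gives the room needed for the dilation. -/
theorem exists_orthonormal_mem_orthogonal (hH : ¬ FiniteDimensional ℂ H) (V : Submodule ℂ H)
    [FiniteDimensional ℂ V] (N : ℕ) : ∃ w : Fin N → H, Orthonormal ℂ w ∧ ∀ i, w i ∈ Vᗮ := by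
  have hV : ¬ Module.Finite ℂ Vᗮ := fun h => by
    apply hH
    have h1 : FiniteDimensional ℂ (V ⊔ Vᗮ : Submodule ℂ H) := Submodule.finiteDimensional_sup _ _
    rw [Submodule.sup_orthogonal_of_hasOrthogonalProjection] at h1
    exact Module.Finite.equiv (Submodule.topEquiv : (⊤ : Submodule ℂ H) ≃ₗ[ℂ] H)
  rw [← Module.rank_lt_aleph0_iff, not_lt] at hV
  obtain ⟨v, hv⟩ := exists_linearIndependent_of_le_rank
    ((Cardinal.natCast_lt_aleph0 (n := N)).le.trans hV)
  refine ⟨fun i => (InnerProductSpace.gramSchmidtNormed ℂ v i : Vᗮ), ?_, fun i => Subtype.coe_prop _⟩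
  exact (InnerProductSpace.gramSchmidtNormed_orthonormal hv).comp_linearIsometry Vᗮ.subtypeₗᵢ

/-- A finite Bessel system with bound `B` is `B` times the mean of two orthonormal systems. -/
theorem exists_orthonormal_dilation (hH : ¬ FiniteDimensional ℂ H) {N : ℕ} (f : Fin N → H) {B : ℝ}
    (hB : 0 < B) (hf : ∀ c : Fin N → ℂ, ‖∑ k, c k • f k‖ ^ 2 ≤ B ^ 2 * ∑ k, ‖c k‖ ^ 2) :
    ∃ u u' : Fin N → H, Orthonormal ℂ u ∧ Orthonormal ℂ u' ∧
      ∀ k, f k = (B / 2 : ℂ) • (u k + u' k) := by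
  have hB' : (B : ℂ) ≠ 0 := by exact_mod_cast hB.ne'
  have := FiniteDimensional.span_of_finite ℂ (Set.finite_range f)
  obtain ⟨w, hw, hwV⟩ := exists_orthonormal_mem_orthogonal hH (Submodule.span ℂ (Set.range f)) N
  -- The defect of the Gram matrix of f; the Bessel inequality says precisely that it is positive
  -- semidefinite.
  set P : Matrix (Fin N) (Fin N) ℂ := ((B : ℂ) ^ 2) • (1 : Matrix (Fin N) (Fin N) ℂ) -
    Matrix.gram ℂ f with hP
  have hPherm : P.IsHermitian := by
    refine Matrix.IsHermitian.sub ?_ (Matrix.isHermitian_gram ℂ f)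
    ext i j
    by_cases h : i = j
    · subst h
      simp
    · simp [h, Ne.symm h]
  have hPpsd : P.PosSemidef := by
    refine Matrix.PosSemidef.of_dotProduct_mulVec_nonneg hPherm fun x => ?_
    have h1 : star x ⬝ᵥ (P *ᵥ x) =
        ((B ^ 2 * ∑ k, ‖x k‖ ^ 2 - ‖∑ k, x k • f k‖ ^ 2 : ℝ) : ℂ) := by
      have h2 : (((‖∑ k, x k • f k‖ ^ 2 : ℝ)) : ℂ) = star x ⬝ᵥ (Matrix.gram ℂ f *ᵥ x) := by
        have := inner_self_eq_norm_sq_to_K (𝕜 := ℂ) (∑ k, x k • f k)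
        rw [Complex.ofReal_pow]
        refine Eq.trans this.symm ?_
        simp only [sum_inner, inner_sum, inner_smul_left, inner_smul_right, dotProduct,
          Matrix.mulVec, Matrix.gram_apply, Pi.star_apply, RCLike.star_def, Finset.mul_sum]
        rw [Finset.sum_comm]
        refine Finset.sum_congr rfl fun i _ => Finset.sum_congr rfl fun j _ => by ring
      have h3 : star x ⬝ᵥ x = ((∑ k, ‖x k‖ ^ 2 : ℝ) : ℂ) := by
        simp only [dotProduct, Pi.star_apply, RCLike.star_def, Complex.ofReal_sum]
        refine Finset.sum_congr rfl fun i _ => ?_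
        rw [Complex.conj_mul']
        push_cast
        rfl
      rw [hP, Matrix.sub_mulVec, dotProduct_sub, Matrix.smul_mulVec, Matrix.one_mulVec,
        dotProduct_smul, h3, ← h2]
      push_cast
      rfl
    rw [h1]
    exact_mod_cast sub_nonneg.2 (hf x)
  obtain ⟨M, hM⟩ := CStarAlgebra.nonneg_iff_eq_star_mul_self.mp hPpsd.nonneg
  -- With P = M*M, the vectors g have Gram matrix P and are orthogonal to all f. Hence both f + g
  -- and f - g have Gram matrix B² times the identity.
  set g : Fin N → H := fun i => ∑ l, M l i • w l with hg
  have hgV : ∀ i, g i ∈ (Submodule.span ℂ (Set.range f))ᗮ := fun i =>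
    Submodule.sum_mem _ fun l _ => Submodule.smul_mem _ _ (hwV l)
  have hfg : ∀ i j, ⟪f i, g j⟫_ℂ = 0 := fun i j =>
    Submodule.inner_right_of_mem_orthogonal (Submodule.subset_span (Set.mem_range_self i)) (hgV j)
  have hgf : ∀ i j, ⟪g i, f j⟫_ℂ = 0 := fun i j => inner_eq_zero_symm.1 (hfg j i)
  have hgg : ∀ i j, ⟪g i, g j⟫_ℂ = P i j := fun i j => by
    rw [hM, hg, Matrix.star_eq_conjTranspose, Matrix.mul_apply]
    simp only [Matrix.conjTranspose_apply, RCLike.star_def]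
    rw [hw.inner_sum]
  have hP' : ∀ i j, ⟪f i, f j⟫_ℂ + P i j = if i = j then (B : ℂ) ^ 2 else 0 := fun i j => by
    rw [hP, Matrix.sub_apply, Matrix.gram_apply, Matrix.smul_apply, Matrix.one_apply]
    split_ifs <;> simp
  have hfin : ∀ i j : Fin N, (B : ℂ)⁻¹ * ((B : ℂ)⁻¹ * if i = j then (B : ℂ) ^ 2 else 0) =
      if i = j then 1 else 0 := fun i j => by
    split_ifs
    · field_simp
    · simp
  refine ⟨fun k => (B : ℂ)⁻¹ • (f k + g k), fun k => (B : ℂ)⁻¹ • (f k - g k), ?_, ?_, fun k => ?_⟩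
  · rw [orthonormal_iff_ite]
    intro i j
    rw [← hfin i j, ← hP' i j, ← hgg i j]
    simp only [inner_smul_left, inner_smul_right, inner_add_left, inner_add_right, hfg, hgf,
      map_inv₀, Complex.conj_ofReal]
    ring
  · rw [orthonormal_iff_ite]
    intro i j
    rw [← hfin i j, ← hP' i j, ← hgg i j]
    simp only [inner_smul_left, inner_smul_right, inner_sub_left, inner_sub_right, hfg, hgf,
      map_inv₀, Complex.conj_ofReal]
    ring
  · rw [← smul_add, add_add_sub_cancel, ← two_smul ℂ, smul_smul, smul_smul]
    rw [show (B / 2 : ℂ) * (B : ℂ)⁻¹ * 2 = 1 by field_simp, one_smul]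

/-! ### Almost summing operators on Bessel systems -/

variable {E : Type*} [NormedAddCommGroup E] [NormedSpace ℂ E]

theorem eLpNorm_gaussianSum_orthonormal_le (R : H →L[ℂ] E) {N : ℕ} {u : Fin N → H}
    (hu : Orthonormal ℂ u) :
    eLpNorm (fun γ : Fin N → ℝ => ∑ n, (γ n : ℂ) • R (u n)) 2 (stdGaussianPi N) ≤
      almostSummingNorm R :=
  le_iSup_of_le N (le_iSup_of_le u (le_iSup_of_le hu le_rfl))

/-- After the dilation, the triangle inequality in L² suffices, since each orthonormal half costs at
most the almost summing norm. -/
theorem eLpNorm_gaussianSum_bessel_le (hH : ¬ FiniteDimensional ℂ H) (R : H →L[ℂ] E) {N : ℕ}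
    (f : Fin N → H) {B : ℝ} (hB : 0 < B)
    (hf : ∀ c : Fin N → ℂ, ‖∑ k, c k • f k‖ ^ 2 ≤ B ^ 2 * ∑ k, ‖c k‖ ^ 2) :
    eLpNorm (fun γ : Fin N → ℝ => ∑ n, (γ n : ℂ) • R (f n)) 2 (stdGaussianPi N) ≤
      ENNReal.ofReal B * almostSummingNorm R := by
  obtain ⟨u, u', hu, hu', huf⟩ := exists_orthonormal_dilation hH f hB hf
  have key : (fun γ : Fin N → ℝ => ∑ n, (γ n : ℂ) • R (f n)) =
      (B / 2 : ℂ) • ((fun γ : Fin N → ℝ => ∑ n, (γ n : ℂ) • R (u n)) +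
        fun γ : Fin N → ℝ => ∑ n, (γ n : ℂ) • R (u' n)) := by
    ext γ
    simp only [Pi.smul_apply, Pi.add_apply, ← Finset.sum_add_distrib, Finset.smul_sum]
    refine Finset.sum_congr rfl fun n _ => ?_
    rw [huf n, map_smul, map_add, smul_comm, smul_add]
  have hnorm : ‖(B / 2 : ℂ)‖ₑ * 2 = ENNReal.ofReal B := by
    rw [← ofReal_norm, norm_div, Complex.norm_real, Real.norm_of_nonneg hB.le]
    rw [show (2 : ℝ≥0∞) = ENNReal.ofReal 2 by simp, ← ENNReal.ofReal_mul (by positivity)]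
    simp
  rw [key, eLpNorm_const_smul, ← hnorm, mul_assoc]
  gcongr
  refine (eLpNorm_add_le (memLp_gaussianSum _).1 (memLp_gaussianSum _).1 one_le_two).trans ?_
  rw [two_mul]
  exact add_le_add (eLpNorm_gaussianSum_orthonormal_le R hu)
    (eLpNorm_gaussianSum_orthonormal_le R hu')

/-- Images of a Bessel system under an almost summing operator-valued map form an R-bounded
family. -/
theorem norm_randomSum_bessel_le [CompleteSpace E] {F : Type*} [NormedAddCommGroup F]
    [NormedSpace ℂ F] (hH : ¬ FiniteDimensional ℂ H) (Θ : F →L[ℂ] (H →L[ℂ] E)) {K : ℝ}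
    (hK : 0 ≤ K) (hΘ : ∀ y, almostSummingNorm (Θ y) ≤ ENNReal.ofReal (K * ‖y‖)) {m : ℕ}
    (f : Fin m → H) {B : ℝ} (hB : 0 < B)
    (hf : ∀ c : Fin m → ℂ, ‖∑ k, c k • f k‖ ^ 2 ≤ B ^ 2 * ∑ k, ‖c k‖ ^ 2)
    {ι : Type*} [Fintype ι] [DecidableEq ι] (k : ι → Fin m) (y : ι → F) :
    ‖randomSum fun n => Θ (y n) (f (k n))‖ ≤ B * K / gaussianAbsMoment * ‖randomSum y‖ := by
  have hμ := gaussianAbsMoment_pos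
  have h1 : ∀ z : F, gaussianAbsMoment ^ 2 * ‖randomSum fun j => Θ z (f j)‖ ^ 2 ≤
      2 ^ m * (B * K * ‖z‖) ^ 2 := fun z => by
    refine (sum_signs_le_integral_gaussianSum _).trans ?_
    gcongr
    refine integral_gaussianSum_le_of_eLpNorm_le (by positivity)
      ((eLpNorm_gaussianSum_bessel_le hH (Θ z) f hB hf).trans ?_)
    rw [mul_assoc B, ENNReal.ofReal_mul hB.le]
    gcongr
    exact hΘ z
  have h2 : gaussianAbsMoment ^ 2 * (2 ^ m * ‖randomSum fun n => Θ (y n) (f (k n))‖ ^ 2) ≤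
      2 ^ m * ((B * K) ^ 2 * ‖randomSum y‖ ^ 2) := by
    have hd := norm_randomSum_diagonal_le k fun j n => Θ (y n) (f j)
    have hcard : (Fintype.card (Fin m → ℤˣ) : ℝ) = 2 ^ m := by simp
    rw [hcard] at hd
    calc _ ≤ gaussianAbsMoment ^ 2 * ∑ ε : Fin m → ℤˣ,
          ‖randomSum fun n => ∑ j, ((ε j : ℤˣ) : ℤ) • Θ (y n) (f j)‖ ^ 2 := by gcongr
      -- Interchanging the two sign averages fixes r first. By linearity of Θ the inner sum then
      -- involves the single vector ∑ rₙ yₙ, so `h1` applies.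
      _ = ∑ r : ι → ℤˣ, gaussianAbsMoment ^ 2 *
          ‖randomSum fun j => Θ (∑ n, ((r n : ℤˣ) : ℤ) • y n) (f j)‖ ^ 2 := by
          simp_rw [norm_randomSum_sq]
          rw [Finset.sum_comm, Finset.mul_sum]
          refine Finset.sum_congr rfl fun r _ => ?_
          congr 1
          refine Finset.sum_congr rfl fun ε _ => ?_
          congr 2
          simp only [map_sum, map_zsmul, FunLike.coe_sum, Finset.sum_apply, Finset.smul_sum]
          rw [Finset.sum_comm]
          refine Finset.sum_congr rfl fun j _ => Finset.sum_congr rfl fun n _ => ?_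
          rw [smul_comm]
          rfl
      _ ≤ ∑ r : ι → ℤˣ, 2 ^ m * (B * K * ‖∑ n, ((r n : ℤˣ) : ℤ) • y n‖) ^ 2 :=
          Finset.sum_le_sum fun r _ => h1 _
      _ = _ := by
          rw [norm_randomSum_sq, Finset.mul_sum, Finset.mul_sum]
          refine Finset.sum_congr rfl fun r _ => ?_
          ring
  rw [div_mul_eq_mul_div, le_div_iff₀ hμ, ← sq_le_sq₀ (by positivity) (by positivity)]
  have h3 : (0 : ℝ) < 2 ^ m := by positivity
  refine le_of_mul_le_mul_left ?_ h3
  calc _ = gaussianAbsMoment ^ 2 * (2 ^ m * ‖randomSum fun n => Θ (y n) (f (k n))‖ ^ 2) := by ring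
    _ ≤ _ := h2
    _ = _ := by ring

end Dilation

/-- The indicators of [n, n + 1) form an infinite orthonormal system. -/
theorem not_finiteDimensional_L2_halfLine : ¬ FiniteDimensional ℂ (Lp ℂ 2 halfLine) := by
  intro h
  have hfin : ∀ n : ℕ, halfLine (Set.Ico (n : ℝ) (n + 1)) ≠ ∞ := fun n =>
    ((Measure.restrict_apply_le _ _).trans_lt measure_Ico_lt_top).ne
  have ho : Orthonormal ℂ fun n : ℕ => indicatorConstLp 2 (μ := halfLine)
      (measurableSet_Ico (a := (n : ℝ)) (b := n + 1)) (hfin n) (1 : ℂ) := by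
    rw [orthonormal_iff_ite]
    intro i j
    rw [L2.inner_indicatorConstLp_one_indicatorConstLp_one _ _ (hfin i) (hfin j)]
    split_ifs with hij
    · subst hij
      rw [Set.inter_self, measureReal_def, halfLine, Measure.restrict_apply measurableSet_Ico,
        Set.inter_eq_left.2 fun x (hx : x ∈ Set.Ico (i : ℝ) (i + 1)) =>
          Set.mem_Ici.2 ((Nat.cast_nonneg i).trans hx.1)]
      simp
    · have : Set.Ico (i : ℝ) (i + 1) ∩ Set.Ico (j : ℝ) (j + 1) = ∅ := by
        ext x
        simp only [Set.mem_inter_iff, Set.mem_Ico, Set.mem_empty_iff_false, iff_false]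
        rintro ⟨⟨h1, h2⟩, h3, h4⟩
        apply hij
        have h5 : i < j + 1 := by exact_mod_cast h1.trans_lt h4
        have h6 : j < i + 1 := by exact_mod_cast h3.trans_lt h2
        omega
      simp [this]
  have := ho.linearIndependent.finite
  exact not_finite ℕ

end

noncomputable section

/-! ### Exponentials in `L²(ℝ₊)` -/

section Exponentials

open scoped InnerProductSpace ComplexConjugate

theorem coeFn_expL2 {z : ℂ} (hz : 0 < z.re) :
    expL2 z hz =ᵐ[halfLine] fun t : ℝ => Complex.exp (-z * t) :=
  MemLp.coeFn_toLp _

theorem integral_exp_halfLine {z : ℂ} (hz : 0 < z.re) :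
    ∫ t : ℝ, Complex.exp (-z * t) ∂halfLine = z⁻¹ := by
  rw [halfLine, integral_Ici_eq_integral_Ioi, integral_exp_mul_complex_Ioi (by simpa using hz)]
  simp

theorem inner_expL2 {z w : ℂ} (hz : 0 < z.re) (hw : 0 < w.re) :
    ⟪expL2 z hz, expL2 w hw⟫_ℂ = (conj z + w)⁻¹ := by
  rw [L2.inner_def, ← integral_exp_halfLine (z := conj z + w) (by simp; linarith)]
  refine integral_congr_ae ?_
  filter_upwards [coeFn_expL2 hz, coeFn_expL2 hw] with t h1 h2
  rw [h1, h2, RCLike.inner_apply, ← Complex.exp_conj, ← Complex.exp_add]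
  congr 1
  simp
  ring

theorem ae_halfLine_nonneg : ∀ᵐ t ∂halfLine, 0 ≤ t :=
  ae_restrict_mem measurableSet_Ici

/-- The extension of `expL2` by `0` to the whole plane. -/
def expL2' (z : ℂ) : Lp ℂ 2 halfLine := if hz : 0 < z.re then expL2 z hz else 0

theorem expL2'_eq {z : ℂ} (hz : 0 < z.re) : expL2' z = expL2 z hz := dif_pos hz

theorem norm_t_mul_exp_le {a t : ℝ} (ha : 0 < a) :
    t * Real.exp (-a * t) ≤ 2 / a * Real.exp (-(a / 2) * t) := by
  have h1 : a / 2 * t ≤ Real.exp (a / 2 * t) := by linarith [Real.add_one_le_exp (a / 2 * t)]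
  calc t * Real.exp (-a * t) = 2 / a * ((a / 2 * t) * Real.exp (-a * t)) := by field_simp
    _ ≤ 2 / a * (Real.exp (a / 2 * t) * Real.exp (-a * t)) := by gcongr
    _ = 2 / a * Real.exp (-(a / 2) * t) := by
      rw [← Real.exp_add]
      congr 2
      ring

theorem norm_exp_neg_mul (z : ℂ) (t : ℝ) : ‖Complex.exp (-z * t)‖ = Real.exp (-z.re * t) := by
  simp [Complex.norm_exp]

theorem memLp_deriv_exp_halfLine {z : ℂ} (hz : 0 < z.re) :
    MemLp (fun t : ℝ => -(t : ℂ) * Complex.exp (-z * t)) 2 halfLine := by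
  have h2 : 0 < ((z.re / 2 : ℝ) : ℂ).re := by simpa using hz
  refine (memLp_exp_halfLine h2).of_le_mul (c := 2 / z.re)
    (Continuous.aestronglyMeasurable (by fun_prop)) ?_
  filter_upwards [ae_halfLine_nonneg] with t ht
  rw [norm_mul, norm_neg, Complex.norm_real, Real.norm_of_nonneg ht, norm_exp_neg_mul,
    norm_exp_neg_mul]
  exact norm_t_mul_exp_le hz

/-- With a = Re z, the second-order remainder is at most (‖h‖t)² e^{at/4} e^{-at}. The factor t² is
traded for e^{at/2}, which leaves the square-integrable decay e^{-at/4}. -/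
theorem exp_taylor_bound {z h : ℂ} {t : ℝ} (ht : 0 ≤ t) (hz : 0 < z.re) (hh : ‖h‖ ≤ z.re / 4) :
    ‖Complex.exp (-(z + h) * t) - Complex.exp (-z * t) - h * (-(t : ℂ) * Complex.exp (-z * t))‖ ≤
      8 / z.re ^ 2 * ‖h‖ ^ 2 * Real.exp (-(z.re / 4) * t) := by
  set a := z.re with ha
  have e1 : Complex.exp (-(z + h) * t) - Complex.exp (-z * t) -
      h * (-(t : ℂ) * Complex.exp (-z * t)) =
      Complex.exp (-z * t) * (Complex.exp (-h * t) -
        ∑ m ∈ Finset.range 2, (-h * t) ^ m / (m.factorial : ℂ)) := by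
    rw [show -(z + h) * (t : ℂ) = -z * t + -h * t by ring, Complex.exp_add]
    simp [Finset.sum_range_succ]
    ring
  rw [e1, norm_mul, norm_exp_neg_mul]
  have h1 := Complex.norm_exp_sub_sum_le_norm_mul_exp (-h * t) 2
  have h2 : ‖-h * (t : ℂ)‖ = ‖h‖ * t := by
    rw [norm_mul, norm_neg, Complex.norm_real, Real.norm_of_nonneg ht]
  rw [h2] at h1
  have h3 : Real.exp (‖h‖ * t) ≤ Real.exp (a / 4 * t) := by gcongr
  have h4 : (a * t / 2) ^ 2 / 2 ≤ Real.exp (a / 2 * t) := by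
    have h5 := Real.quadratic_le_exp_of_nonneg (x := a / 2 * t) (by positivity)
    have h6 : 0 ≤ a / 2 * t := by positivity
    nlinarith
  calc _ ≤ Real.exp (-a * t) * ((‖h‖ * t) ^ 2 * Real.exp (a / 4 * t)) := by
        gcongr
        exact h1.trans (by gcongr)
    _ = 8 / a ^ 2 * ‖h‖ ^ 2 * (((a * t / 2) ^ 2 / 2) * Real.exp (-a * t) * Real.exp (a / 4 * t)) := by
        field_simp
        ring
    _ ≤ 8 / a ^ 2 * ‖h‖ ^ 2 * (Real.exp (a / 2 * t) * Real.exp (-a * t) * Real.exp (a / 4 * t)) := by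
        gcongr
    _ = _ := by
        rw [← Real.exp_add, ← Real.exp_add]
        congr 2
        ring

/-- The pointwise Taylor bound makes the L²-remainder quadratic in w - z. Holomorphy is what later
permits Cauchy's formula. -/
theorem differentiableAt_expL2' {z : ℂ} (hz : 0 < z.re) : DifferentiableAt ℂ expL2' z := by
  set d : Lp ℂ 2 halfLine := (memLp_deriv_exp_halfLine hz).toLp _ with hd
  have h4 : 0 < ((z.re / 4 : ℝ) : ℂ).re := by simpa using hz
  set C : ℝ := 8 / z.re ^ 2 * ‖expL2 _ h4‖
  have key : ∀ᶠ w in 𝓝 z, ‖expL2' w - (expL2' z + (w - z) • d)‖ ≤ C * ‖‖w - z‖ ^ 2‖ := by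
    have hball : Metric.ball z (z.re / 4) ∈ 𝓝 z := Metric.ball_mem_nhds _ (by positivity)
    filter_upwards [hball] with w hw
    have hwz : ‖w - z‖ ≤ z.re / 4 := (mem_ball_iff_norm.1 hw).le
    have hw0 : 0 < w.re := by
      have h1 := (Complex.abs_re_le_norm (w - z)).trans hwz
      rw [Complex.sub_re] at h1
      linarith [(abs_le.1 h1).1]
    rw [expL2'_eq hw0, expL2'_eq hz, Real.norm_of_nonneg (by positivity), mul_right_comm]
    refine Lp.norm_le_mul_norm_of_ae_le_mul ?_
    filter_upwards [ae_halfLine_nonneg, coeFn_expL2 hw0, coeFn_expL2 hz, coeFn_expL2 h4,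
      Lp.coeFn_sub (expL2 w hw0) (expL2 z hz + (w - z) • d),
      Lp.coeFn_add (expL2 z hz) ((w - z) • d), Lp.coeFn_smul (w - z) d,
      (memLp_deriv_exp_halfLine hz).coeFn_toLp] with t ht h1 h2 h3 h4 h5 h6 h7
    rw [h4, Pi.sub_apply, h5, Pi.add_apply, h6, Pi.smul_apply, hd, h7, h1, h2, h3,
      norm_exp_neg_mul, smul_eq_mul, ← sub_sub]
    have := exp_taylor_bound (h := w - z) ht hz hwz
    rwa [add_sub_cancel] at this
  have hO : (fun w => expL2' w - (expL2' z + (w - z) • d)) =O[𝓝 z] fun w => ‖w - z‖ ^ 2 :=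
    Asymptotics.IsBigO.of_bound C key
  have h1 : DifferentiableAt ℂ (fun w => expL2' w - (expL2' z + (w - z) • d)) z :=
    (hO.hasFDerivAt (𝕜 := ℂ) one_lt_two).differentiableAt
  have h2 : DifferentiableAt ℂ (fun w => expL2' z + (w - z) • d) z := by fun_prop
  have := h1.add h2
  refine this.congr_of_eventuallyEq (Eventually.of_forall fun w => ?_)
  simp

/-! ### The Bessel inequality for exponentials on vertical lattices -/

/-- The constant `∑_{n ∈ ℤ} 1 / (1 + n²)`. -/
def latticeSum : ℝ := ∑' n : ℤ, 1 / (1 + (n : ℝ) ^ 2)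

theorem summable_latticeSum : Summable fun n : ℤ => 1 / (1 + (n : ℝ) ^ 2) := by
  refine Summable.of_norm_bounded_eventually (Real.summable_one_div_int_pow.2 one_lt_two) ?_
  have : ({0} : Set ℤ)ᶜ ∈ Filter.cofinite := (Set.finite_singleton 0).compl_mem_cofinite
  filter_upwards [this] with n hn
  have h0 : (n : ℝ) ≠ 0 := by exact_mod_cast hn
  rw [Real.norm_of_nonneg (by positivity)]
  gcongr
  linarith

theorem latticeSum_pos : 0 < latticeSum :=
  summable_latticeSum.tsum_pos (fun n => by positivity) 0 (by norm_num)

theorem norm_sum_smul_expL2_sq {m : ℕ} {ζ : Fin m → ℂ} (hζ : ∀ k, 0 < (ζ k).re) (c : Fin m → ℂ) :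
    ((‖∑ k, c k • expL2 (ζ k) (hζ k)‖ ^ 2 : ℝ) : ℂ) =
      ∑ j, ∑ k, conj (c j) * c k * (conj (ζ j) + ζ k)⁻¹ := by
  have := inner_self_eq_norm_sq_to_K (𝕜 := ℂ) (∑ k, c k • expL2 (ζ k) (hζ k))
  rw [Complex.ofReal_pow]
  refine Eq.trans this.symm ?_
  simp only [sum_inner, inner_sum, inner_smul_left, inner_smul_right, inner_expL2, Finset.mul_sum]
  rw [Finset.sum_comm]
  exact Finset.sum_congr rfl fun i _ => Finset.sum_congr rfl fun j _ => by ring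

/-- Exponentials `e_ζ` with `ζ` in a vertical lattice of step `A` form a Bessel system. -/
theorem bessel_expL2 {m : ℕ} {ζ : Fin m → ℂ} (hζ : ∀ k, 0 < (ζ k).re) {A a b : ℝ}
    (hA : 0 < A) (ha : A / 2 ≤ a) (ha' : a ≤ 5 * A / 2) {l : Fin m → ℤ}
    (hl : Function.Injective l) (hre : ∀ k, (ζ k).re = a) (him : ∀ k, (ζ k).im = b + A * l k)
    (c : Fin m → ℂ) :
    ‖∑ k, c k • expL2 (ζ k) (hζ k)‖ ^ 2 ≤ √(10 * latticeSum / A) ^ 2 * ∑ k, ‖c k‖ ^ 2 := by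
  have hS := latticeSum_pos
  have ha0 : 0 < a := by linarith
  rw [Real.sq_sqrt (by positivity)]
  set w : ℤ → ℝ := fun n => 10 / A * (1 / (1 + (n : ℝ) ^ 2)) with hw
  have hw0 : ∀ n, 0 ≤ w n := fun n => by positivity
  have hwneg : ∀ n, w (-n) = w n := fun n => by simp [hw]
  have hsw : Summable w := summable_latticeSum.mul_left _
  have htw : ∑' n, w n = 10 * latticeSum / A := by
    rw [hw, tsum_mul_left, ← latticeSum]
    ring
  have hrow : ∀ j, ∑ k, w (l k - l j) ≤ 10 * latticeSum / A := fun j => by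
    rw [← htw]
    have hinj : Function.Injective fun k => l k - l j := fun k k' h => hl (by simpa using h)
    have := hsw.sum_le_tsum (Finset.univ.map ⟨_, hinj⟩) fun n _ => hw0 n
    rwa [Finset.sum_map] at this
  have hrow' : ∀ k, ∑ j, w (l k - l j) ≤ 10 * latticeSum / A := fun k => by
    refine le_trans (le_of_eq ?_) (hrow k)
    refine Finset.sum_congr rfl fun j _ => ?_
    rw [← hwneg, neg_sub]
  have hconj : ∀ j k, conj (ζ j) + ζ k = 2 * a + A * ((l k - l j : ℤ) : ℂ) * Complex.I := by
    intro j k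
    apply Complex.ext
    · simp [hre]
      ring
    · simp [him]
      ring
  -- The Gram kernel 1/q(n) decays only like 1/|n| and is not absolutely summable, whereas 1/q(n) +
  -- 1/q(-n) = 4a/(4a² + A²n²) is.
  set q : ℤ → ℂ := fun n => 2 * a + A * (n : ℂ) * Complex.I with hq
  have hq0 : ∀ n, q n ≠ 0 := fun n h => by
    have := congrArg Complex.re h
    simp [hq] at this
    linarith
  have hqsum : ∀ n, ‖(q n)⁻¹ + (q (-n))⁻¹‖ ≤ w n := fun n => by
    have h1 : (q n)⁻¹ + (q (-n))⁻¹ = ((4 * a / (4 * a ^ 2 + A ^ 2 * n ^ 2) : ℝ) : ℂ) := by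
      have h2 : q n * q (-n) = ((4 * a ^ 2 + A ^ 2 * n ^ 2 : ℝ) : ℂ) := by
        simp only [hq]
        push_cast
        linear_combination (-(A : ℂ) ^ 2 * n ^ 2) * Complex.I_sq
      have h3 : q n + q (-n) = ((4 * a : ℝ) : ℂ) := by
        simp only [hq]
        push_cast
        ring
      rw [inv_add_inv (hq0 n) (hq0 (-n)), h2, h3]
      push_cast
      rfl
    rw [h1, Complex.norm_real, Real.norm_of_nonneg (by positivity), hw]
    simp only
    rw [div_mul_div_comm, mul_one, div_le_div_iff₀ (by positivity) (by positivity)]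
    have h5 : A ^ 2 ≤ 4 * a ^ 2 := by nlinarith
    have h6 : 4 * a * A ≤ 10 * A ^ 2 := by nlinarith
    have h7 : A ^ 2 * (1 + (n : ℝ) ^ 2) ≤ 4 * a ^ 2 + A ^ 2 * n ^ 2 := by linarith
    calc 4 * a * (A * (1 + (n : ℝ) ^ 2)) = 4 * a * A * (1 + (n : ℝ) ^ 2) := by ring
      _ ≤ 10 * A ^ 2 * (1 + (n : ℝ) ^ 2) := by gcongr
      _ = 10 * (A ^ 2 * (1 + (n : ℝ) ^ 2)) := by ring
      _ ≤ 10 * (4 * a ^ 2 + A ^ 2 * n ^ 2) := by linarith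
  have h1 := norm_sum_smul_expL2_sq hζ c
  -- Conjugating the coefficients transposes the kernel. Adding this second, nonnegative square
  -- produces the summable symmetrised kernel and can be dropped at the end.
  have h2 := norm_sum_smul_expL2_sq hζ fun k => conj (c k)
  rw [Finset.sum_comm] at h2
  have h3 : ((‖∑ k, c k • expL2 (ζ k) (hζ k)‖ ^ 2 + ‖∑ k, conj (c k) • expL2 (ζ k) (hζ k)‖ ^ 2 : ℝ)
      : ℂ) = ∑ j, ∑ k, conj (c j) * c k * ((q (l k - l j))⁻¹ + (q (-(l k - l j)))⁻¹) := by
    rw [Complex.ofReal_add, h1, h2, ← Finset.sum_add_distrib]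
    refine Finset.sum_congr rfl fun j _ => ?_
    rw [← Finset.sum_add_distrib]
    refine Finset.sum_congr rfl fun k _ => ?_
    rw [hconj, hconj, neg_sub, Complex.conj_conj]
    simp only [hq]
    ring
  have h4 : ‖∑ k, c k • expL2 (ζ k) (hζ k)‖ ^ 2 +
      ‖∑ k, conj (c k) • expL2 (ζ k) (hζ k)‖ ^ 2 ≤
      ∑ j, ∑ k, (‖c j‖ ^ 2 + ‖c k‖ ^ 2) / 2 * w (l k - l j) := by
    have h5 := congrArg norm h3
    rw [Complex.norm_real, Real.norm_of_nonneg (by positivity)] at h5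
    rw [h5]
    refine (norm_sum_le _ _).trans (Finset.sum_le_sum fun j _ => ?_)
    refine (norm_sum_le _ _).trans (Finset.sum_le_sum fun k _ => ?_)
    rw [norm_mul, norm_mul, RCLike.norm_conj]
    have h6 : ‖c j‖ * ‖c k‖ ≤ (‖c j‖ ^ 2 + ‖c k‖ ^ 2) / 2 := by
      nlinarith [sq_nonneg (‖c j‖ - ‖c k‖)]
    exact mul_le_mul h6 (hqsum _) (norm_nonneg _) (by positivity)
  -- Schur's test, with row and column sums bounded by ∑ w.
  have h5 : ∑ j, ∑ k, (‖c j‖ ^ 2 + ‖c k‖ ^ 2) / 2 * w (l k - l j) ≤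
      10 * latticeSum / A * ∑ k, ‖c k‖ ^ 2 := by
    have e1 : ∑ j, ∑ k, (‖c j‖ ^ 2 + ‖c k‖ ^ 2) / 2 * w (l k - l j) =
        (∑ j, ‖c j‖ ^ 2 / 2 * ∑ k, w (l k - l j)) +
        ∑ k, ‖c k‖ ^ 2 / 2 * ∑ j, w (l k - l j) := by
      simp_rw [Finset.mul_sum]
      rw [Finset.sum_comm (f := fun k j => ‖c k‖ ^ 2 / 2 * w (l k - l j)), ← Finset.sum_add_distrib]
      refine Finset.sum_congr rfl fun j _ => ?_
      rw [← Finset.sum_add_distrib]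
      exact Finset.sum_congr rfl fun k _ => by ring
    rw [e1]
    calc _ ≤ (∑ j, ‖c j‖ ^ 2 / 2 * (10 * latticeSum / A)) +
          ∑ k, ‖c k‖ ^ 2 / 2 * (10 * latticeSum / A) := by
          gcongr with j _ k _
          · exact hrow j
          · exact hrow' k
      _ = _ := by
          rw [← Finset.sum_mul, ← Finset.sum_div]
          ring
  have h6 : 0 ≤ ‖∑ k, conj (c k) • expL2 (ζ k) (hζ k)‖ ^ 2 := by positivity
  linarith

end Exponentials

end

noncomputable section

/-! ### R-boundedness of Laplace transforms -/

section LaplaceTransform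

variable {E : Type*} [NormedAddCommGroup E] [NormedSpace ℂ E]
  {F : Type*} [NormedAddCommGroup F] [NormedSpace ℂ F]
  {ι : Type*} [Fintype ι] [DecidableEq ι]

/-- Several points may share a lattice node, while the Bessel inequality requires distinct nodes. -/
theorem exists_injective_factorization {α β : Type*} [Finite β] (g : β → α) :
    ∃ (m : ℕ) (l : Fin m → α) (k : β → Fin m), Function.Injective l ∧ ∀ n, l (k n) = g n := by
  obtain ⟨m, ⟨e⟩⟩ := Finite.exists_equiv_fin (Set.range g)
  exact ⟨m, fun i => e.symm i, fun n => e ⟨g n, n, rfl⟩,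
    Subtype.coe_injective.comp e.symm.injective, fun n => by simp⟩

/-- The constant in the R-bound on a strip. -/
def stripConst : ℝ := 8 * √(10 * latticeSum) / gaussianAbsMoment

theorem stripConst_pos : 0 < stripConst := by
  have := latticeSum_pos
  have := gaussianAbsMoment_pos
  unfold stripConst
  positivity

/-- The factor 8 is reserved for Cauchy's formula: its kernel is bounded by 4, and complex
contraction costs another 2. -/
theorem norm_randomSum_lattice_le [CompleteSpace E] (Θ : F →L[ℂ] (Lp ℂ 2 halfLine →L[ℂ] E))
    {K : ℝ} (hK : 0 ≤ K) (hΘ : ∀ y, almostSummingNorm (Θ y) ≤ ENNReal.ofReal (K * ‖y‖))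
    {A a b : ℝ} (hA : 0 < A) (ha : A / 2 ≤ a) (ha' : a ≤ 5 * A / 2) {ζ : ι → ℂ} (g : ι → ℤ)
    (hre : ∀ n, (ζ n).re = a) (him : ∀ n, (ζ n).im = b + A * g n) (y : ι → F) :
    8 * ‖randomSum fun n => Θ (y n) (expL2' (ζ n))‖ ≤ stripConst * K / √A * ‖randomSum y‖ := by
  have hS := latticeSum_pos
  obtain ⟨m, l, k, hl, hlk⟩ := exists_injective_factorization g
  set ξ : Fin m → ℂ := fun j => ⟨a, b + A * l j⟩ with hξ
  have hξ0 : ∀ j, 0 < (ξ j).re := fun j => by simp only [hξ]; linarith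
  have hζ : ∀ n, expL2' (ζ n) = expL2 (ξ (k n)) (hξ0 _) := fun n => by
    rw [← expL2'_eq]
    congr 1
    apply Complex.ext
    · exact hre n
    · simp only [hξ, hlk]
      exact him n
  have h := norm_randomSum_bessel_le not_finiteDimensional_L2_halfLine Θ hK hΘ
    (fun j => expL2 (ξ j) (hξ0 j)) (B := √(10 * latticeSum / A)) (by positivity)
    (bessel_expL2 hξ0 hA ha ha' hl (fun _ => rfl) fun _ => rfl) k y
  simp_rw [hζ]
  calc _ ≤ 8 * (√(10 * latticeSum / A) * K / gaussianAbsMoment * ‖randomSum y‖) := by gcongr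
    _ = _ := by
      rw [Real.sqrt_div (by positivity), stripConst]
      ring

/-- Each value is a Cauchy integral over the circle of radius A around the centre of the cell
containing the point. For a fixed angle all circle points lie on one translated lattice, so the
lattice bound holds under the integral, uniformly in the angle. -/
theorem norm_randomSum_strip_le [CompleteSpace E] (Θ : F →L[ℂ] (Lp ℂ 2 halfLine →L[ℂ] E))
    {K : ℝ} (hK : 0 ≤ K) (hΘ : ∀ y, almostSummingNorm (Θ y) ≤ ENNReal.ofReal (K * ‖y‖))
    {A : ℝ} (hA : 0 < A) {z : ι → ℂ} (hz : ∀ n, A ≤ (z n).re) (hz' : ∀ n, (z n).re ≤ 2 * A)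
    (y : ι → F) :
    ‖randomSum fun n => Θ (y n) (expL2' (z n))‖ ≤ stripConst * K / √A * ‖randomSum y‖ := by
  set g : ι → ℤ := fun n => ⌊(z n).im / A⌋ with hg
  -- Centres of the A × A cells of the strip. Each point is within A/√2 < 3A/4 of its centre, hence
  -- at least A/4 from the circle of radius A, which itself lies in A/2 ≤ Re w ≤ 5A/2.
  set c : ι → ℂ := fun n => ⟨3 * A / 2, A / 2 + A * g n⟩ with hc
  have hzc : ∀ n, ‖z n - c n‖ ≤ 3 / 4 * A := fun n => by
    have h1 : |(z n - c n).re| ≤ A / 2 := by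
      rw [abs_le, Complex.sub_re]
      constructor <;> simp only [hc] <;> linarith [hz n, hz' n]
    have h2 : |(z n - c n).im| ≤ A / 2 := by
      have h3 := Int.floor_le ((z n).im / A)
      have h4 := Int.lt_floor_add_one ((z n).im / A)
      rw [le_div_iff₀ hA] at h3
      rw [div_lt_iff₀ hA] at h4
      rw [abs_le, Complex.sub_im]
      constructor <;> simp only [hc, hg] <;> linarith
    rw [← sq_le_sq₀ (norm_nonneg _) (by positivity), Complex.sq_norm, Complex.normSq_apply,
      ← pow_two, ← pow_two]
    have h5 := sq_le_sq' (abs_le.1 h1).1 (abs_le.1 h1).2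
    have h6 := sq_le_sq' (abs_le.1 h2).1 (abs_le.1 h2).2
    nlinarith
  have hpos : ∀ n, ∀ w ∈ Metric.closedBall (c n) A, 0 < w.re := fun n w hw => by
    have h1 := (Complex.abs_re_le_norm (w - c n)).trans (mem_closedBall_iff_norm.1 hw)
    rw [Complex.sub_re] at h1
    have := (abs_le.1 h1).1
    simp only [hc] at this
    linarith
  have hdiff : ∀ n, DifferentiableOn ℂ (fun w => Θ (y n) (expL2' w)) (Metric.closedBall (c n) A) :=
    fun n w hw => ((Θ (y n)).differentiableAt.comp w
      (differentiableAt_expL2' (hpos n w hw))).differentiableWithinAt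
  have hmem : ∀ n, z n ∈ Metric.ball (c n) A := fun n => by
    rw [mem_ball_iff_norm]
    linarith [hzc n]
  set coef : ℝ → ι → ℂ := fun θ n => circleMap 0 A θ * Complex.I * (circleMap (c n) A θ - z n)⁻¹
    with hcoef
  set Φ : ℝ → ι → E := fun θ n => coef θ n • Θ (y n) (expL2' (circleMap (c n) A θ)) with hΦ
  have hcircle : ∀ n θ, circleMap (c n) A θ - c n = circleMap 0 A θ := fun n θ => by
    simp [circleMap]
  have hnormc : ∀ θ, ‖circleMap 0 A θ‖ = A := fun θ => by
    rw [norm_circleMap_zero, abs_of_pos hA]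
  have hlow : ∀ n θ, A / 4 ≤ ‖circleMap (c n) A θ - z n‖ := fun n θ => by
    have h1 : circleMap 0 A θ = (circleMap (c n) A θ - z n) + (z n - c n) := by
      rw [← hcircle n θ]
      ring
    have h2 := norm_add_le (circleMap (c n) A θ - z n) (z n - c n)
    rw [← h1, hnormc] at h2
    linarith [hzc n]
  have hcoefle : ∀ θ n, ‖coef θ n‖ ≤ 4 := fun θ n => by
    simp only [hcoef]
    rw [norm_mul, norm_mul, hnormc, Complex.norm_I, mul_one, norm_inv, ← div_eq_mul_inv,
      div_le_iff₀ (lt_of_lt_of_le (by positivity) (hlow n θ))]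
    linarith [hlow n θ]
  have hcont : ∀ n, Continuous fun θ => Φ θ n := fun n => by
    have h1 : Continuous fun θ => Θ (y n) (expL2' (circleMap (c n) A θ)) :=
      (hdiff n).continuousOn.comp_continuous (continuous_circleMap _ _)
        fun θ => circleMap_mem_closedBall _ hA.le _
    have h2 : Continuous fun θ => coef θ n := by
      refine ((continuous_circleMap _ _).mul continuous_const).mul
        (((continuous_circleMap _ _).sub continuous_const).inv₀ fun θ h => ?_)
      have := hlow n θ
      rw [show circleMap (c n) A θ - z n = 0 from h, norm_zero] at this
      linarith
    exact h2.smul h1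
  have hΦc : Continuous Φ := continuous_pi hcont
  have hΦi : IntervalIntegrable Φ volume 0 (2 * Real.pi) := hΦc.intervalIntegrable _ _
  have hcauchy : (fun n => Θ (y n) (expL2' (z n))) =
      (2 * Real.pi * Complex.I : ℂ)⁻¹ • ∫ θ in (0 : ℝ)..2 * Real.pi, Φ θ := by
    ext n
    rw [Pi.smul_apply]
    have h1 := (ContinuousLinearMap.proj (R := ℂ) (φ := fun _ : ι => E) n).intervalIntegral_comp_comm
      hΦi
    simp only [ContinuousLinearMap.proj_apply] at h1
    have h2 := ((hdiff n).mono Metric.closure_ball_subset_closedBall).diffContOnCl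
      |>.two_pi_i_inv_smul_circleIntegral_sub_inv_smul (hmem n)
    rw [← h1, ← h2, circleIntegral]
    congr 1
    refine intervalIntegral.integral_congr fun θ _ => ?_
    simp only [hΦ, hcoef, deriv_circleMap, mul_smul]
  have hbound : ∀ θ, ‖randomSum (Φ θ)‖ ≤ stripConst * K / √A * ‖randomSum y‖ := fun θ => by
    refine (norm_randomSum_smul_le _ (by norm_num : (0 : ℝ) < 4) (hcoefle θ)).trans ?_
    have hre : |(circleMap 0 A θ).re| ≤ A := (Complex.abs_re_le_norm _).trans (hnormc θ).le
    have h8 : (2 : ℝ) * 4 = 8 := by norm_num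
    rw [h8]
    refine norm_randomSum_lattice_le Θ hK hΘ hA (a := 3 * A / 2 + (circleMap 0 A θ).re)
      (b := A / 2 + (circleMap 0 A θ).im) ?_ ?_ g (fun n => ?_) (fun n => ?_) y
    · linarith [(abs_le.1 hre).1]
    · linarith [(abs_le.1 hre).2]
    · rw [← hcircle n θ, Complex.sub_re]
      simp [hc]
    · rw [← hcircle n θ, Complex.sub_im]
      simp only [hc]
      ring
  rw [hcauchy, map_smul, ← randomSum.intervalIntegral_comp_comm hΦi, norm_smul]
  have h1 := intervalIntegral.norm_integral_le_of_norm_le_const (a := 0) (b := 2 * Real.pi)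
    (f := fun θ => randomSum (Φ θ)) fun θ _ => hbound θ
  have hpi := Real.pi_pos
  have h2 : ‖(2 * Real.pi * Complex.I : ℂ)⁻¹‖ = (2 * Real.pi)⁻¹ := by
    simp [abs_of_pos hpi]
  rw [sub_zero, abs_of_pos (by positivity)] at h1
  rw [h2]
  calc _ ≤ (2 * Real.pi)⁻¹ * (stripConst * K / √A * ‖randomSum y‖ * (2 * Real.pi)) := by gcongr
    _ = _ := by field_simp

/-- The constant in the R-bound on a half-plane. -/
def halfPlaneConst : ℝ := stripConst * ∑' j : ℕ, (1 / √2) ^ j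

theorem one_div_sqrt_two_lt_one : 1 / √2 < 1 := by
  rw [div_lt_one (by positivity)]
  exact Real.lt_sqrt_of_sq_lt (by norm_num)

theorem summable_geometric_sqrt_two : Summable fun j : ℕ => (1 / √2) ^ j :=
  summable_geometric_of_lt_one (by positivity) one_div_sqrt_two_lt_one

theorem halfPlaneConst_pos : 0 < halfPlaneConst :=
  mul_pos stripConst_pos
    (summable_geometric_sqrt_two.tsum_pos (fun j => by positivity) 0 (by norm_num))

/-- The dyadic strip starting at 2^j δ contributes a multiple of (2^j δ)^{-1/2}, and these bounds
form a convergent geometric series. -/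
theorem norm_randomSum_halfPlane_le [CompleteSpace E] (Θ : F →L[ℂ] (Lp ℂ 2 halfLine →L[ℂ] E))
    {K : ℝ} (hK : 0 ≤ K) (hΘ : ∀ y, almostSummingNorm (Θ y) ≤ ENNReal.ofReal (K * ‖y‖))
    {δ : ℝ} (hδ : 0 < δ) {z : ι → ℂ} (hz : ∀ n, δ ≤ (z n).re) (y : ι → F) :
    ‖randomSum fun n => Θ (y n) (expL2' (z n))‖ ≤
      K * (halfPlaneConst / √δ) * ‖randomSum y‖ := by
  have hex : ∀ n, ∃ j : ℕ, 2 ^ j * δ ≤ (z n).re ∧ (z n).re ≤ 2 * (2 ^ j * δ) := fun n => by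
    obtain ⟨j, h1, h2⟩ := exists_nat_pow_near (x := (z n).re / δ) (y := (2 : ℝ))
      ((one_le_div hδ).2 (hz n)) one_lt_two
    refine ⟨j, (le_div_iff₀ hδ).1 h1, ?_⟩
    have := ((div_lt_iff₀ hδ).1 h2).le
    rw [pow_succ] at this
    linarith
  choose J hJ1 hJ2 using hex
  set s := Finset.univ.image J with hs
  set yj : ℕ → ι → F := fun j n => (((if J n = j then 1 else 0 : ℝ)) : ℂ) • y n with hyj
  -- Indices outside strip j carry the vector 0; the default point 2^j δ only keeps them inside the
  -- strip.
  set zj : ℕ → ι → ℂ := fun j n => if J n = j then z n else ((2 ^ j * δ : ℝ) : ℂ) with hzj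
  have hyle : ∀ j, ‖randomSum (yj j)‖ ≤ ‖randomSum y‖ := fun j =>
    norm_randomSum_real_smul_le y fun n => by split_ifs <;> simp
  have hdec : (fun n => Θ (y n) (expL2' (z n))) =
      ∑ j ∈ s, fun n => Θ (yj j n) (expL2' (zj j n)) := by
    ext n
    rw [Finset.sum_apply, Finset.sum_eq_single (J n)]
    · simp [hyj, hzj]
    · intro j _ hj
      simp [hyj, Ne.symm hj]
    · intro h
      exact absurd (Finset.mem_image_of_mem J (Finset.mem_univ n)) h
  have hj : ∀ j ∈ s, ‖randomSum fun n => Θ (yj j n) (expL2' (zj j n))‖ ≤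
      stripConst * K / √δ * ‖randomSum y‖ * (1 / √2) ^ j := fun j _ => by
    have hpos : 0 < 2 ^ j * δ := by positivity
    have h1 := norm_randomSum_strip_le Θ hK hΘ (A := 2 ^ j * δ) hpos (z := zj j)
      (fun n => ?_) (fun n => ?_) (yj j)
    · have hsq : √(2 ^ j * δ) = √2 ^ j * √δ := by
        rw [Real.sqrt_mul (by positivity)]
        congr 1
        rw [Real.sqrt_eq_iff_mul_self_eq (by positivity) (by positivity), ← mul_pow]
        simp
      have hst := stripConst_pos
      calc _ ≤ stripConst * K / √(2 ^ j * δ) * ‖randomSum (yj j)‖ := h1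
        _ ≤ stripConst * K / √(2 ^ j * δ) * ‖randomSum y‖ := by gcongr; exact hyle j
        _ = _ := by
          rw [hsq, div_pow, one_pow]
          field_simp
    · simp only [hzj]
      split_ifs with h
      · exact h ▸ hJ1 n
      · rw [Complex.ofReal_re]
    · simp only [hzj]
      split_ifs with h
      · exact h ▸ hJ2 n
      · rw [Complex.ofReal_re]
        linarith
  rw [hdec, map_sum]
  refine (norm_sum_le _ _).trans ((Finset.sum_le_sum hj).trans ?_)
  rw [← Finset.mul_sum]
  have hst := stripConst_pos
  calc _ ≤ stripConst * K / √δ * ‖randomSum y‖ * ∑' j : ℕ, (1 / √2) ^ j := by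
        gcongr
        exact summable_geometric_sqrt_two.sum_le_tsum _ fun j _ => by positivity
    _ = _ := by
        rw [halfPlaneConst]
        ring

theorem isRBoundedWith_laplaceTransform [CompleteSpace E]
    (Θ : F →L[ℂ] (Lp ℂ 2 halfLine →L[ℂ] E)) {K δ : ℝ} (hK : 0 ≤ K) (hδ : 0 < δ)
    (hΘ : ∀ y, almostSummingNorm (Θ y) ≤ ENNReal.ofReal (K * ‖y‖)) :
    IsRBoundedWith {S | ∃ (z : ℂ) (hz : 0 < z.re), δ ≤ z.re ∧ S = laplaceTransform Θ z hz}
      (K * (halfPlaneConst / √δ)) := by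
  have hC := halfPlaneConst_pos
  rw [isRBoundedWith_iff]
  refine ⟨by positivity, fun N S x hS => ?_⟩
  choose z hz hδz hSz using hS
  have h := norm_randomSum_halfPlane_le Θ hK hΘ hδ hδz x
  convert h using 4 with n
  rw [hSz n, expL2'_eq (hz n)]
  rfl

end LaplaceTransform

end

noncomputable section

/-! ### Extension of R-bounds for resolvents across a vertical line -/

section ResolventExtension

variable {E : Type*} [NormedAddCommGroup E] [NormedSpace ℂ E] {A : E →ₗ.[ℂ] E}

/-- The resolvent identity, from applying S to (w - A) R x = x + (w - z) R x. -/
theorem IsResolventAt.apply_eq {z w : ℂ} {R S : E →L[ℂ] E} (hR : IsResolventAt A z R)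
    (hS : IsResolventAt A w S) (x : E) : R x = S x + (w - z) • S (R x) := by
  obtain ⟨hx, e⟩ := hR.1 x
  have h1 := hS.2 ⟨R x, hx⟩
  have h2 : w • R x - A ⟨R x, hx⟩ = x + (w - z) • R x := by
    rw [sub_smul]
    nth_rewrite 3 [← e]
    abel
  simp only at h1
  rw [h2, map_add, map_smul] at h1
  exact h1.symm

/-- Neumann series: the resolvent at z is R (1 - (w - z) R)⁻¹. -/
theorem IsResolventAt.mem_resolventSet_of_norm_lt [CompleteSpace E] {z w : ℂ} {R : E →L[ℂ] E}
    (hR : IsResolventAt A w R) (h : ‖w - z‖ * ‖R‖ < 1) : z ∈ pmapResolventSet A := by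
  have hlt : ‖(w - z) • R‖ < 1 := by rwa [norm_smul]
  set U := Units.oneSub ((w - z) • R) hlt
  set V : E →L[ℂ] E := ↑U⁻¹ with hV
  have hU : (U : E →L[ℂ] E) = 1 - (w - z) • R := rfl
  have hUV : ∀ x, V x - (w - z) • R (V x) = x := fun x => by
    have := congrArg (fun S : E →L[ℂ] E => S x) U.mul_inv
    rw [hU] at this
    simpa using this
  have hVU : ∀ x, V (x - (w - z) • R x) = x := fun x => by
    have := congrArg (fun S : E →L[ℂ] E => S x) U.inv_mul
    rw [hU] at this
    simpa using this
  have hcomm : ∀ x, V (R x) = R (V x) := fun x => by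
    have h1 : R x = R (V x) - (w - z) • R (R (V x)) := by
      rw [← map_smul, ← map_sub, hUV]
    rw [h1, hVU]
  refine ⟨R.comp V, fun x => ?_, fun x => ?_⟩
  · obtain ⟨hx, e⟩ := hR.1 (V x)
    refine ⟨hx, ?_⟩
    have h2 : z • R (V x) - A ⟨R (V x), hx⟩ =
        (w • R (V x) - A ⟨R (V x), hx⟩) - (w - z) • R (V x) := by
      rw [sub_smul]
      abel
    exact h2.trans (by rw [e, hUV])
  · have h3 : z • (x : E) - A x = (w • (x : E) - A x) - (w - z) • (x : E) := by
      rw [sub_smul]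
      abel
    rw [ContinuousLinearMap.comp_apply, ← hcomm, h3, map_sub, hR.2, map_smul, hVU]

theorem norm_randomSum_fin_one (y : E) : ‖randomSum fun _ : Fin 1 => y‖ = √2 * ‖y‖ := by
  rw [← Real.sqrt_sq (norm_nonneg (randomSum _)), norm_randomSum_sq]
  have : ∀ r : Fin 1 → ℤˣ, ‖∑ n, ((r n : ℤˣ) : ℤ) • y‖ = ‖y‖ := fun r => by
    rcases Int.units_eq_one_or (r 0) with h | h <;> simp [h]
  simp_rw [this]
  simp

theorem norm_le_of_isRBoundedWith {F : Type*} [NormedAddCommGroup F] [NormedSpace ℂ F]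
    {𝒯 : Set (F →L[ℂ] E)} {C : ℝ} (h : IsRBoundedWith 𝒯 C) {S : F →L[ℂ] E} (hS : S ∈ 𝒯) :
    ‖S‖ ≤ C := by
  refine S.opNorm_le_bound h.1 fun x => ?_
  have h1 := (isRBoundedWith_iff.1 h).2 1 (fun _ => S) (fun _ => x) fun _ => hS
  rw [norm_randomSum_fin_one, norm_randomSum_fin_one] at h1
  have h3 : 0 < √(2 : ℝ) := by positivity
  exact le_of_mul_le_mul_left (by linarith) h3

theorem halfPlane_subset_resolventSet [CompleteSpace E] {δ κ H : ℝ}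
    (hδ : {z : ℂ | δ ≤ z.re} ⊆ pmapResolventSet A)
    (hR : IsRBoundedWith (pmapResolvent A '' {z : ℂ | δ ≤ z.re}) κ) (hH : 0 ≤ H)
    (hκ : H * κ < 1) : {z : ℂ | δ - H ≤ z.re} ⊆ pmapResolventSet A := by
  intro z hz
  by_cases h : δ ≤ z.re
  · exact hδ h
  · push Not at h
    have hw : δ ≤ ((⟨δ, z.im⟩ : ℂ)).re := le_rfl
    refine (pmapResolvent_spec (hδ hw)).mem_resolventSet_of_norm_lt ?_
    have h1 : (⟨δ, z.im⟩ : ℂ) - z = ((δ - z.re : ℝ) : ℂ) := by apply Complex.ext <;> simp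
    have h2 : δ - H ≤ z.re := hz
    rw [h1, Complex.norm_real, Real.norm_of_nonneg (by linarith)]
    refine lt_of_le_of_lt ?_ hκ
    gcongr
    · linarith
    · exact norm_le_of_isRBoundedWith hR ⟨_, hw, rfl⟩

/-- The term (w - z) R(w) R(z) in the resolvent identity is absorbed into the left side, because Hκ
< 1. The shift w - z is real, so contraction costs no factor 2; this keeps the admissible H as large
as any H < 1/κ. -/
theorem isRBounded_pmapResolvent_extension [CompleteSpace E] {δ κ H : ℝ}
    (hδ : {z : ℂ | δ ≤ z.re} ⊆ pmapResolventSet A)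
    (hR : IsRBoundedWith (pmapResolvent A '' {z : ℂ | δ ≤ z.re}) κ) (hH : 0 < H)
    (hκ : H * κ < 1) :
    IsRBoundedWith (pmapResolvent A '' {z : ℂ | δ - H ≤ z.re}) (κ / (1 - H * κ)) := by
  have hsub := halfPlane_subset_resolventSet hδ hR hH.le hκ
  have hκ0 := hR.1
  have h1κ : 0 < 1 - H * κ := by linarith
  rw [isRBoundedWith_iff] at hR ⊢
  refine ⟨by positivity, fun N S x hS => ?_⟩
  choose z hz hzS using hS
  -- Horizontal shift to the line Re = δ, equal to 0 for points already to its right.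
  set h : Fin N → ℝ := fun n => max δ (z n).re - (z n).re with hh
  set w : Fin N → ℂ := fun n => z n + (h n : ℂ) with hw
  have hh0 : ∀ n, 0 ≤ h n := fun n => sub_nonneg.2 (le_max_right _ _)
  have hhH : ∀ n, h n ≤ H := fun n => by
    have := hz n
    simp only [Set.mem_ofPred_eq] at this
    rw [hh, sub_le_iff_le_add]
    exact max_le (by linarith) (by linarith)
  have hwδ : ∀ n, w n ∈ {z : ℂ | δ ≤ z.re} := fun n => by
    simp [hw, hh]
  set u : Fin N → E := fun n => S n (x n) with hu
  have hdec : u = (fun n => pmapResolvent A (w n) (x n)) +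
      (fun n => pmapResolvent A (w n) ((h n : ℂ) • u n)) := by
    ext n
    rw [Pi.add_apply]
    simp only [hu]
    rw [← hzS n, map_smul]
    rw [(pmapResolvent_spec (hsub (hz n))).apply_eq (pmapResolvent_spec (hδ (hwδ n))) (x n)]
    congr 2
    · simp [hw]
    · rw [← (pmapResolvent_spec (hsub (hz n))).apply_eq (pmapResolvent_spec (hδ (hwδ n))) (x n)]
  have h1 := hR.2 N (fun n => pmapResolvent A (w n)) x fun n => ⟨w n, hwδ n, rfl⟩
  have h2 := hR.2 N (fun n => pmapResolvent A (w n)) (fun n => (h n : ℂ) • u n)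
    fun n => ⟨w n, hwδ n, rfl⟩
  have h3 : ‖randomSum fun n => (h n : ℂ) • u n‖ ≤ H * ‖randomSum u‖ := by
    have h4 : (fun n => (h n : ℂ) • u n) = (H : ℂ) • fun n => ((h n / H : ℝ) : ℂ) • u n := by
      ext n
      have : (H : ℂ) ≠ 0 := by exact_mod_cast hH.ne'
      rw [Pi.smul_apply, smul_smul]
      congr 1
      push_cast
      field_simp
    rw [h4, map_smul, norm_smul, Complex.norm_real, Real.norm_of_nonneg hH.le]
    gcongr
    refine norm_randomSum_real_smul_le u fun n => ?_
    rw [abs_of_nonneg (div_nonneg (hh0 n) hH.le), div_le_one hH]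
    exact hhH n
  have h5 : ‖randomSum u‖ ≤ κ * ‖randomSum x‖ + κ * (H * ‖randomSum u‖) := by
    conv_lhs => rw [hdec, map_add]
    exact (norm_add_le _ _).trans (add_le_add h1 (h2.trans (by gcongr)))
  rw [div_mul_eq_mul_div, le_div_iff₀ h1κ]
  linarith

end ResolventExtension

/-! ### Laplace transforms of semigroup orbits -/

section Semigroup

variable {E : Type*} [NormedAddCommGroup E] [NormedSpace ℂ E]

theorem gammaInftyNorm_eq {φ : ℝ → E} {R : Lp ℂ 2 halfLine →L[ℂ] E} (h : IsPettisOperator φ R) :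
    gammaInftyNorm φ = almostSummingNorm R :=
  le_antisymm (iInf₂_le R h) (le_iInf₂ fun _ hR' => (h.unique hR') ▸ le_rfl)

theorem continuous_orbit (T : C0Semigroup E) (x : E) : Continuous (T.orbit x) :=
  (T.continuous_orbit x).comp continuous_real_toNNReal

theorem orbit_zero (T : C0Semigroup E) (x : E) : T.orbit x 0 = x := by
  simp [C0Semigroup.orbit, T.op_zero]

theorem orbit_op {T : C0Semigroup E} (x : E) {t : ℝ} (ht : 0 ≤ t) (h : ℝ≥0) :
    T.orbit (T.op h x) t = T.orbit x (t + h) := by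
  rw [C0Semigroup.orbit, C0Semigroup.orbit, Real.toNNReal_add ht h.coe_nonneg, Real.toNNReal_coe, T.op_add]
  rfl

theorem op_orbit {T : C0Semigroup E} (x : E) {t : ℝ} (ht : 0 ≤ t) (h : ℝ≥0) :
    T.op h (T.orbit x t) = T.orbit x (t + h) := by
  rw [C0Semigroup.orbit, C0Semigroup.orbit, Real.toNNReal_add ht h.coe_nonneg, Real.toNNReal_coe, add_comm,
    T.op_add]
  rfl

theorem exists_norm_op_le [CompleteSpace E] (T : C0Semigroup E) (b : ℝ≥0) :
    ∃ M, ∀ t ≤ b, ‖T.op t‖ ≤ M := by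
  obtain ⟨M, hM⟩ := banach_steinhaus (g := fun t : Set.Iic b => T.op t) fun x => by
    obtain ⟨C, hC⟩ := (isCompact_Icc (a := (0 : ℝ≥0)) (b := b)).exists_bound_of_continuousOn
      (T.continuous_orbit x).continuousOn
    exact ⟨C, fun t => hC t ⟨zero_le, t.2⟩⟩
  exact ⟨M, fun t ht => hM ⟨t, ht⟩⟩

/-- The Riesz representative of D has integral 0 over every compact set, hence vanishes almost
everywhere. -/
theorem eq_zero_of_indicator_eq_zero (D : Lp ℂ 2 halfLine →L[ℂ] ℂ)
    (hD : ∀ f : Lp ℂ 2 halfLine, ∀ s : Set ℝ, IsCompact s →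
      f =ᵐ[halfLine] s.indicator (fun _ => (1 : ℂ)) → D f = 0) : D = 0 := by
  set h := (InnerProductSpace.toDual ℂ (Lp ℂ 2 halfLine)).symm D with hh
  have : IsLocallyFiniteMeasure halfLine :=
    inferInstanceAs (IsLocallyFiniteMeasure (volume.restrict _))
  have hloc : LocallyIntegrable h halfLine := (Lp.memLp h).locallyIntegrable one_le_two
  have h0 : h =ᵐ[halfLine] 0 := by
    refine ae_eq_zero_of_forall_setIntegral_isCompact_eq_zero' hloc fun s hs => ?_
    have hfin : halfLine s ≠ ∞ := ((Measure.restrict_apply_le _ _).trans_lt hs.measure_lt_top).ne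
    rw [← L2.inner_indicatorConstLp_one hs.measurableSet hfin h, ← inner_conj_symm, hh,
      InnerProductSpace.toDual_symm_apply, hD _ s hs indicatorConstLp_coeFn, map_zero]
  have h1 : h = 0 := (Lp.eq_zero_iff_ae_eq_zero).2 h0
  exact (LinearIsometryEquiv.map_eq_zero_iff _).1 h1

theorem integrable_mul_weak {φ : ℝ → E} (hφ : ∀ ψ : E →L[ℂ] ℂ, MemLp (fun t => ψ (φ t)) 2 halfLine)
    (f : Lp ℂ 2 halfLine) (ψ : E →L[ℂ] ℂ) : Integrable (fun t => f t * ψ (φ t)) halfLine :=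
  (Lp.memLp f).integrable_mul (hφ ψ)

/-- The operator-valued map `x ↦ R_{T(·)x}`. -/
theorem exists_pettis_map [CompleteSpace E] {T : C0Semigroup E}
    (hT : ∀ x, MemGammaInfty (T.orbit x)) :
    ∃ Θ : E →L[ℂ] (Lp ℂ 2 halfLine →L[ℂ] E), ∀ x, IsPettisOperator (T.orbit x) (Θ x) := by
  choose R hR _ using fun x => (hT x).2.2
  have hw := fun x => (hT x).2.1
  have hadd : ∀ x y, R (x + y) = R x + R y := fun x y => (hR (x + y)).unique fun f ψ => by
    rw [add_apply, map_add, hR x f ψ, hR y f ψ,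
      ← integral_add (integrable_mul_weak (hw x) f ψ) (integrable_mul_weak (hw y) f ψ)]
    refine integral_congr_ae (Eventually.of_forall fun t => ?_)
    simp [C0Semigroup.orbit, mul_add]
  have hsmul : ∀ (c : ℂ) x, R (c • x) = c • R x := fun c x => (hR (c • x)).unique fun f ψ => by
    rw [smul_apply, map_smul, hR x f ψ, smul_eq_mul, ← integral_const_mul]
    refine integral_congr_ae (Eventually.of_forall fun t => ?_)
    simp [C0Semigroup.orbit]
    ring
  set L : E →ₗ[ℂ] (Lp ℂ 2 halfLine →L[ℂ] E) :=
    { toFun := R, map_add' := hadd, map_smul' := hsmul } with hL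
  -- The limit is identified on indicators of compact sets only, where local boundedness of the
  -- semigroup permits dominated convergence.
  refine ⟨⟨L, L.continuous_of_seq_closed_graph fun u x S hu hS => ?_⟩, hR⟩
  rw [← sub_eq_zero]
  ext f
  rw [zero_apply, SeparatingDual.eq_zero_iff_forall_dual_eq_zero (R := ℂ)]
  intro ψ
  suffices h : ψ.comp (S - L x) = 0 from congrArg (fun D : Lp ℂ 2 halfLine →L[ℂ] ℂ => D f) h
  refine eq_zero_of_indicator_eq_zero _ fun f s hs hf => ?_
  have hint : ∀ y, ψ (R y f) = ∫ t in s, ψ (T.orbit y t) ∂halfLine := fun y => by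
    rw [hR y f ψ, ← integral_indicator hs.measurableSet]
    refine integral_congr_ae ?_
    filter_upwards [hf] with t ht
    rw [ht]
    by_cases h : t ∈ s <;> simp [h]
  obtain ⟨b, hb⟩ := hs.bddAbove
  obtain ⟨M, hM⟩ := exists_norm_op_le T b.toNNReal
  have h1 : Tendsto (fun n => ψ (R (u n) f)) atTop (𝓝 (ψ (S f))) := by
    have h2 : Tendsto (fun n => R (u n) f) atTop (𝓝 (S f)) :=
      ((ContinuousLinearMap.apply ℂ E f).continuous.tendsto S).comp hS
    exact (ψ.continuous.tendsto _).comp h2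
  have hfin : halfLine s < ∞ := (Measure.restrict_apply_le _ _).trans_lt hs.measure_lt_top
  have h2 : Tendsto (fun n => ψ (R (u n) f)) atTop (𝓝 (ψ (R x f))) := by
    obtain ⟨Cu, hCu⟩ := hu.norm.bddAbove_range
    simp_rw [hint]
    refine tendsto_integral_of_dominated_convergence (fun _ => ‖ψ‖ * (M * Cu)) (fun n => ?_)
      (integrableOn_const hfin.ne) (fun n => ?_) (Eventually.of_forall fun t => ?_)
    · exact (ψ.continuous.comp (continuous_orbit T _)).aestronglyMeasurable
    · filter_upwards [ae_restrict_mem hs.measurableSet] with t ht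
      refine (ψ.le_opNorm _).trans ?_
      gcongr
      refine ((T.op t.toNNReal).le_opNorm _).trans ?_
      have h3 := hM t.toNNReal (Real.toNNReal_le_toNNReal (hb ht))
      exact mul_le_mul h3 (hCu ⟨n, rfl⟩) (norm_nonneg _) ((norm_nonneg _).trans h3)
    · exact (ψ.continuous.tendsto _).comp (((T.op t.toNNReal).continuous.tendsto _).comp hu)
  have h3 := tendsto_nhds_unique h1 h2
  rw [ContinuousLinearMap.comp_apply, sub_apply, map_sub, h3]
  exact sub_self _

end Semigroup

end

noncomputable section

/-! ### The resolvent as the Laplace transform of the semigroup -/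

section SemigroupResolvent

variable {E : Type*} [NormedAddCommGroup E] [NormedSpace ℂ E]

/-- Pointwise finiteness of the almost summing norm implies a uniform bound. -/
theorem exists_almostSummingNorm_le [CompleteSpace E] {F : Type*} [NormedAddCommGroup F]
    [NormedSpace ℂ F] {H : Type*} [NormedAddCommGroup H] [InnerProductSpace ℂ H]
    (Θ : E →L[ℂ] (H →L[ℂ] F)) (hΘ : ∀ x, almostSummingNorm (Θ x) < ∞) :
    ∃ M : ℝ, 0 < M ∧ ∀ x, almostSummingNorm (Θ x) ≤ ENNReal.ofReal (M * ‖x‖) := by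
  let I := Σ N : ℕ, {h : Fin N → H // Orthonormal ℂ h}
  let G : ∀ i : I, E → (Fin i.1 → ℝ) → F := fun i x γ => ∑ n, (γ n : ℂ) • Θ x (i.2.1 n)
  have hG : ∀ i x, MemLp (G i x) 2 (stdGaussianPi i.1) := fun i x => memLp_gaussianSum _
  have hle : ∀ i x, eLpNorm (G i x) 2 (stdGaussianPi i.1) ≤ almostSummingNorm (Θ x) := fun i x =>
    eLpNorm_gaussianSum_orthonormal_le (Θ x) i.2.2
  -- One continuous seminorm per orthonormal system. They are pointwise bounded by hypothesis, so
  -- their supremum is continuous because E, being complete, is barrelled.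
  let p : I → Seminorm ℂ E := fun i => Seminorm.of
    (fun x => (eLpNorm (G i x) 2 (stdGaussianPi i.1)).toReal)
    (fun x y => by
      rw [← ENNReal.toReal_add (hG i x).2.ne (hG i y).2.ne]
      refine ENNReal.toReal_mono (ENNReal.add_ne_top.2 ⟨(hG i x).2.ne, (hG i y).2.ne⟩) ?_
      refine le_trans (le_of_eq ?_) (eLpNorm_add_le (hG i x).1 (hG i y).1 one_le_two)
      congr 1
      ext γ
      simp [G, Finset.sum_add_distrib])
    (fun c x => by
      have : G i (c • x) = c • G i x := by
        ext γ
        simp only [G, map_smul, smul_apply, Pi.smul_apply, Finset.smul_sum]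
        exact Finset.sum_congr rfl fun n _ => smul_comm _ _ _
      rw [this, eLpNorm_const_smul, ENNReal.toReal_mul, toReal_enorm])
  have hp : ∀ i x, p i x = (eLpNorm (G i x) 2 (stdGaussianPi i.1)).toReal := fun i x => rfl
  have hcont : ∀ i, Continuous (p i) := fun i => by
    have hS : MemLp (fun γ : Fin i.1 → ℝ => ∑ n, |γ n|) 2 (stdGaussianPi i.1) :=
      memLp_finsetSum _ fun n _ =>
        ((memLp_id_gaussianReal 2).comp_measurePreserving (measurePreserving_eval _ n)).norm
    set c := (eLpNorm (fun γ : Fin i.1 → ℝ => ∑ n, |γ n|) 2 (stdGaussianPi i.1)).toReal with hc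
    have hc0 : 0 ≤ ‖Θ‖ * c := mul_nonneg (norm_nonneg Θ) ENNReal.toReal_nonneg
    let K : ℝ≥0 := ⟨‖Θ‖ * c, hc0⟩
    refine Seminorm.continuous_of_le (q := K • normSeminorm ℂ E)
      (((norm_withSeminorms ℂ E).continuous_seminorm 0).const_smul _) fun x => ?_
    have hb : eLpNorm (G i x) 2 (stdGaussianPi i.1) ≤ ENNReal.ofReal (‖Θ‖ * ‖x‖) *
        eLpNorm (fun γ : Fin i.1 → ℝ => ∑ n, |γ n|) 2 (stdGaussianPi i.1) := by
      refine eLpNorm_le_mul_eLpNorm_of_ae_le_mul (Eventually.of_forall fun γ => ?_) 2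
      rw [Real.norm_of_nonneg (Finset.sum_nonneg fun n _ => abs_nonneg (γ n)), Finset.mul_sum]
      refine (norm_sum_le _ _).trans (Finset.sum_le_sum fun n _ => ?_)
      rw [norm_smul, Complex.norm_real, Real.norm_eq_abs, mul_comm]
      gcongr
      refine ((Θ x).le_opNorm _).trans ?_
      rw [i.2.2.1 n, mul_one]
      exact Θ.le_opNorm x
    have h1 := ENNReal.toReal_mono (ENNReal.mul_ne_top ENNReal.ofReal_ne_top hS.2.ne) hb
    rw [ENNReal.toReal_mul, ENNReal.toReal_ofReal (by positivity)] at h1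
    refine h1.trans (le_of_eq ?_)
    change ‖Θ‖ * ‖x‖ * c = ‖Θ‖ * c * ‖x‖
    ring
  have hbdd : BddAbove (Set.range p) := by
    rw [Seminorm.bddAbove_range_iff]
    intro x
    refine ⟨(almostSummingNorm (Θ x)).toReal, ?_⟩
    rintro _ ⟨i, rfl⟩
    exact ENNReal.toReal_mono (hΘ x).ne (hle i x)
  obtain ⟨M, hM0, hM⟩ := Seminorm.bound_of_continuous_normedSpace (⨆ i, p i)
    (Seminorm.coe_iSup_eq hbdd ▸ Seminorm.continuous_iSup p hcont hbdd)
  refine ⟨M, hM0, fun x => iSup_le fun N => iSup_le fun h => iSup_le fun ho => ?_⟩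
  have h1 := hM x
  rw [Seminorm.iSup_apply hbdd] at h1
  have h2 := (le_ciSup (Seminorm.bddAbove_range_iff.1 hbdd x) (⟨N, h, ho⟩ : I)).trans h1
  rw [hp] at h2
  exact (ENNReal.le_ofReal_iff_toReal_le (hG ⟨N, h, ho⟩ x).2.ne (by positivity)).2 h2

variable {T : C0Semigroup E} {Θ : E →L[ℂ] (Lp ℂ 2 halfLine →L[ℂ] E)}

theorem apply_laplaceTransform (hΘ : ∀ x, IsPettisOperator (T.orbit x) (Θ x)) {z : ℂ}
    (hz : 0 < z.re) (x : E) (ψ : E →L[ℂ] ℂ) :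
    ψ (laplaceTransform Θ z hz x) =
      ∫ t : ℝ in Set.Ici 0, Complex.exp (-z * t) * ψ (T.orbit x t) := by
  refine (hΘ x _ ψ).trans (integral_congr_ae ?_)
  filter_upwards [coeFn_expL2 hz] with t ht
  rw [ht]

theorem op_laplaceTransform_comm (hΘ : ∀ x, IsPettisOperator (T.orbit x) (Θ x)) {z : ℂ}
    (hz : 0 < z.re) (x : E) (h : ℝ≥0) :
    laplaceTransform Θ z hz (T.op h x) = T.op h (laplaceTransform Θ z hz x) := by
  refine (SeparatingDual.eq_iff_forall_dual_eq (R := ℂ)).2 fun ψ => ?_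
  have h1 := apply_laplaceTransform hΘ hz x (ψ.comp (T.op h))
  rw [ContinuousLinearMap.comp_apply] at h1
  rw [h1, apply_laplaceTransform hΘ hz]
  refine setIntegral_congr_fun measurableSet_Ici fun t ht => ?_
  simp only [ContinuousLinearMap.comp_apply, orbit_op x ht, op_orbit x ht]

/-- Substituting t + h in the Laplace integral cuts off [0, h]. That integral exists only weakly,
but the right side depends on h through a norm-convergent integral and can be differentiated in
norm. -/
theorem op_laplaceTransform [CompleteSpace E] (hw : ∀ x, ∀ ψ : E →L[ℂ] ℂ,
      MemLp (fun t => ψ (T.orbit x t)) 2 halfLine)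
    (hΘ : ∀ x, IsPettisOperator (T.orbit x) (Θ x)) {z : ℂ} (hz : 0 < z.re) (x : E) (h : ℝ≥0) :
    T.op h (laplaceTransform Θ z hz x) = Complex.exp (z * (h : ℝ)) • (laplaceTransform Θ z hz x -
      ∫ t in (0 : ℝ)..(h : ℝ), Complex.exp (-z * t) • T.orbit x t) := by
  refine (SeparatingDual.eq_iff_forall_dual_eq (R := ℂ)).2 fun ψ => ?_
  have hcont : Continuous fun t : ℝ => Complex.exp (-z * t) • T.orbit x t :=
    Continuous.smul (by fun_prop) (continuous_orbit T x)
  set g : ℝ → ℂ := fun t => Complex.exp (-z * t) * ψ (T.orbit x t) with hg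
  have hgi : IntegrableOn g (Set.Ici 0) := by
    have := integrable_mul_weak (hw x) (expL2 z hz) ψ
    refine this.congr ?_
    filter_upwards [coeFn_expL2 hz] with t ht
    rw [ht]
  have hgi' : IntegrableOn g (Set.Ioi 0) := hgi.mono_set Set.Ioi_subset_Ici_self
  have h0 : 0 ≤ (h : ℝ) := h.coe_nonneg
  have hshift : ∫ t in Set.Ioi (0 : ℝ), g (t + h) = ∫ t in Set.Ioi (h : ℝ), g t := by
    have := (measurePreserving_add_right volume (h : ℝ)).setIntegral_preimage_emb
      (measurableEmbedding_addRight (h : ℝ)) g (Set.Ioi (h : ℝ))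
    rwa [Set.preimage_add_const_Ioi, sub_self] at this
  have hsplit : ∫ t in Set.Ioi (0 : ℝ), g t =
      (∫ t in Set.Ioc (0 : ℝ) h, g t) + ∫ t in Set.Ioi (h : ℝ), g t := by
    rw [← Set.Ioc_union_Ioi_eq_Ioi h0, setIntegral_union (Set.Ioc_disjoint_Ioi le_rfl)
      measurableSet_Ioi (hgi'.mono_set Set.Ioc_subset_Ioi_self)
      (hgi'.mono_set (Set.Ioi_subset_Ioi h0))]
  have h1 : ψ (T.op h (laplaceTransform Θ z hz x)) =
      Complex.exp (z * (h : ℝ)) * ∫ t in Set.Ioi (0 : ℝ), g (t + h) := by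
    rw [← ContinuousLinearMap.comp_apply, apply_laplaceTransform hΘ hz x (ψ.comp (T.op h)),
      integral_Ici_eq_integral_Ioi, ← integral_const_mul]
    refine setIntegral_congr_fun measurableSet_Ioi fun t ht => ?_
    simp only [hg, ContinuousLinearMap.comp_apply, op_orbit x (le_of_lt ht)]
    rw [← mul_assoc, ← Complex.exp_add]
    congr 2
    push_cast
    ring
  have h2 : ψ (∫ t in (0 : ℝ)..(h : ℝ), Complex.exp (-z * t) • T.orbit x t) =
      ∫ t in Set.Ioc (0 : ℝ) h, g t := by
    rw [← ψ.intervalIntegral_comp_comm (hcont.intervalIntegrable _ _),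
      intervalIntegral.integral_of_le h0]
    simp [hg]
  rw [h1, map_smul, map_sub, h2, apply_laplaceTransform hΘ hz, integral_Ici_eq_integral_Ioi,
    hsplit, hshift, add_sub_cancel_left, smul_eq_mul]

/-- The formula for T(h) on the Laplace transform is differentiated at h = 0. -/
theorem hasGenerator_laplaceTransform [CompleteSpace E] (hw : ∀ x, ∀ ψ : E →L[ℂ] ℂ,
      MemLp (fun t => ψ (T.orbit x t)) 2 halfLine)
    (hΘ : ∀ x, IsPettisOperator (T.orbit x) (Θ x)) {z : ℂ} (hz : 0 < z.re) (x : E) :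
    T.HasGenerator (laplaceTransform Θ z hz x) (z • laplaceTransform Θ z hz x - x) := by
  set u := laplaceTransform Θ z hz x with hu
  set f : ℝ → E := fun h => Complex.exp (z * h) • (u -
    ∫ t in (0 : ℝ)..h, Complex.exp (-z * t) • T.orbit x t) with hf
  have hcont : Continuous fun t : ℝ => Complex.exp (-z * t) • T.orbit x t :=
    Continuous.smul (by fun_prop) (continuous_orbit T x)
  have hd : HasDerivAt f (z • u - x) 0 := by
    have h1 := (hcont.integral_hasStrictDerivAt 0 0).hasDerivAt
    have h2 : HasDerivAt (fun h : ℝ => Complex.exp (z * h)) z 0 := by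
      have h3 : HasDerivAt (fun h : ℝ => z * (h : ℂ)) z 0 := by
        simpa using (Complex.ofRealCLM.hasDerivAt (x := (0 : ℝ))).const_mul z
      simpa using h3.cexp
    have h4 := h2.smul (h1.const_sub u)
    refine h4.congr_deriv ?_
    simp only [Complex.ofReal_zero, mul_zero, Complex.exp_zero, orbit_zero, one_smul,
      intervalIntegral.integral_same, sub_zero]
    abel
  have hs := (hasDerivAt_iff_tendsto_slope.1 hd).mono_left
    (nhdsWithin_mono 0 fun t (ht : 0 < t) => ht.ne')
  refine hs.congr' ?_
  filter_upwards [self_mem_nhdsWithin] with t ht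
  have ht' : 0 < t := ht
  have h5 : T.orbit u t = f t := by
    have := op_laplaceTransform hw hΘ hz x t.toNNReal
    rw [Real.coe_toNNReal _ ht'.le] at this
    exact this
  have h6 : f 0 = u := by simp [hf]
  rw [slope_def_module, h5, h6, sub_zero, ← Complex.ofReal_inv]
  exact (Complex.coe_smul _ _).symm

theorem isResolventAt_laplaceTransform [CompleteSpace E] (hw : ∀ x, ∀ ψ : E →L[ℂ] ℂ,
      MemLp (fun t => ψ (T.orbit x t)) 2 halfLine)
    (hΘ : ∀ x, IsPettisOperator (T.orbit x) (Θ x)) {z : ℂ} (hz : 0 < z.re) :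
    IsResolventAt T.generator z (laplaceTransform Θ z hz) := by
  set S := laplaceTransform Θ z hz with hS
  refine ⟨fun x => ?_, fun x => ?_⟩
  · have hg := hasGenerator_laplaceTransform hw hΘ hz x
    have hmem : S x ∈ T.generator.domain := ⟨_, hg⟩
    refine ⟨hmem, ?_⟩
    rw [(T.generator_spec ⟨S x, hmem⟩).unique hg]
    abel
  -- Left inverse: S commutes with the semigroup, so it carries difference quotients of x to those
  -- of S x, giving S A x = A S x = z S x - x.
  · have hx := T.generator_spec x
    have h1 : T.HasGenerator (S x) (S (T.generator x)) := by
      refine ((S.continuous.tendsto _).comp hx).congr fun t => ?_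
      simp only [Function.comp_apply, map_smul, map_sub]
      congr 2
      exact op_laplaceTransform_comm hΘ hz x t.toNNReal
    rw [map_sub, map_smul, h1.unique (hasGenerator_laplaceTransform hw hΘ hz (x : E))]
    abel

theorem isRBoundedWith_resolvent [CompleteSpace E] (hw : ∀ x, ∀ ψ : E →L[ℂ] ℂ,
      MemLp (fun t => ψ (T.orbit x t)) 2 halfLine)
    (hΘ : ∀ x, IsPettisOperator (T.orbit x) (Θ x)) {M : ℝ} (hM : 0 ≤ M)
    (hΘM : ∀ x, almostSummingNorm (Θ x) ≤ ENNReal.ofReal (M * ‖x‖)) {δ : ℝ} (hδ : 0 < δ) :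
    {z : ℂ | δ ≤ z.re} ⊆ pmapResolventSet T.generator ∧
      IsRBoundedWith (pmapResolvent T.generator '' {z : ℂ | δ ≤ z.re})
        (M * (halfPlaneConst / √δ)) := by
  have hres : ∀ z : ℂ, δ ≤ z.re → ∃ hz : 0 < z.re,
      IsResolventAt T.generator z (laplaceTransform Θ z hz) := fun z hz =>
    ⟨hδ.trans_le hz, isResolventAt_laplaceTransform hw hΘ _⟩
  have hsub : {z : ℂ | δ ≤ z.re} ⊆ pmapResolventSet T.generator := fun z hz =>
    ⟨_, (hres z hz).2⟩
  refine ⟨hsub, ?_⟩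
  have h := isRBoundedWith_laplaceTransform Θ hM hδ hΘM
  refine ⟨h.1, fun N S x hS => h.2 N S x fun n => ?_⟩
  obtain ⟨z, hz, hzS⟩ := hS n
  obtain ⟨hz0, hzr⟩ := hres z hz
  exact ⟨z, hz0, hz, hzS ▸ (pmapResolvent_spec (hsub hz)).unique hzr⟩

/-- With the optimal choice `δ = 1 / (4 c²)`, `c = C M`, the resolvent extends beyond the
imaginary axis. -/
theorem resolvent_extension [CompleteSpace E] (hw : ∀ x, ∀ ψ : E →L[ℂ] ℂ,
      MemLp (fun t => ψ (T.orbit x t)) 2 halfLine)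
    (hΘ : ∀ x, IsPettisOperator (T.orbit x) (Θ x)) {M : ℝ} (hM : 0 < M)
    (hΘM : ∀ x, almostSummingNorm (Θ x) ≤ ENNReal.ofReal (M * ‖x‖)) {ε : ℝ}
    (hε0 : 0 ≤ ε) (hε : ε < 1 / (4 * (halfPlaneConst * M) ^ 2)) :
    {z : ℂ | -ε ≤ z.re} ⊆ pmapResolventSet T.generator ∧
      IsRBounded (pmapResolvent T.generator '' {z : ℂ | -ε ≤ z.re}) := by
  have hC := halfPlaneConst_pos
  set c := halfPlaneConst * M with hc
  have hc0 : 0 < c := mul_pos hC hM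
  -- With κ = c/√δ the extension stops short of δ - 1/κ = δ - √δ/c. This is minimal at √δ = 1/(2c),
  -- where κ = 2c² and the value is -1/(4c²).
  set δ : ℝ := 1 / (4 * c ^ 2) with hδ
  have hδ0 : 0 < δ := by positivity
  obtain ⟨hsub, hR⟩ := isRBoundedWith_resolvent hw hΘ hM.le hΘM hδ0
  have hsqrt : √δ = 1 / (2 * c) := by
    rw [Real.sqrt_eq_iff_mul_self_eq hδ0.le (by positivity), hδ]
    field_simp
    norm_num
  have hκ : M * (halfPlaneConst / √δ) = 2 * c ^ 2 := by
    rw [hsqrt, hc]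
    field_simp
  rw [hκ] at hR
  have hH : 0 < δ + ε := by linarith
  have hlt : (δ + ε) * (2 * c ^ 2) < 1 := by
    have h1 : (δ + δ) * (2 * c ^ 2) = 1 := by
      rw [hδ]
      field_simp
      norm_num
    have h2 : 0 < 2 * c ^ 2 := by positivity
    nlinarith
  have h1 := halfPlane_subset_resolventSet hsub hR hH.le hlt
  have h2 := isRBounded_pmapResolvent_extension hsub hR hH hlt
  rw [sub_add_cancel_left] at h1 h2
  exact ⟨h1, _, h2⟩

theorem spectralBound_le {A : E →ₗ.[ℂ] E} {b : ℝ}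
    (h : ∀ ε, b < -ε → {z : ℂ | -ε ≤ z.re} ⊆ pmapResolventSet A) :
    spectralBound A ≤ (b : EReal) := by
  refine iSup₂_le fun z hz => EReal.coe_le_coe_iff.2 ?_
  by_contra! hlt
  exact hz (h (-z.re) (by simpa using hlt) (by simp))

end SemigroupResolvent

end

/-! ### Assembly of the two assertions -/

theorem theorem3p2 :
    ∃ C : ℝ, 0 < C ∧
      -- `C` is a universal constant in the R-bound of Laplace transforms
      (∀ (E : Type u) [NormedAddCommGroup E] [NormedSpace ℂ E] [CompleteSpace E]
          (F : Type v) [NormedAddCommGroup F] [NormedSpace ℂ F] [CompleteSpace F]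
          (Θ : F →L[ℂ] (Lp ℂ 2 halfLine →L[ℂ] E)) (K δ : ℝ), 0 ≤ K → 0 < δ →
          (∀ y : F, almostSummingNorm (Θ y) ≤ ENNReal.ofReal (K * ‖y‖)) →
          IsRBoundedWith
            {S | ∃ (z : ℂ) (hz : 0 < z.re), δ ≤ z.re ∧ S = laplaceTransform Θ z hz}
            (K * (C / √δ))) ∧
      ∀ (E : Type u) [NormedAddCommGroup E] [NormedSpace ℂ E] [CompleteSpace E]
        (T : C0Semigroup E), (∀ x : E, MemGammaInfty (T.orbit x)) →
        rBoundednessAbscissa T.generator < 0 ∧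
        (∃ ε : ℝ, 0 < ε ∧
          {z : ℂ | -ε ≤ z.re} ⊆ pmapResolventSet T.generator ∧
          IsRBounded (pmapResolvent T.generator '' {z : ℂ | -ε ≤ z.re})) ∧
        (∃ M : ℝ, 0 ≤ M ∧ ∀ x : E, gammaInftyNorm (T.orbit x) ≤ ENNReal.ofReal (M * ‖x‖)) ∧
        ∀ M : ℝ, 0 ≤ M →
          (∀ x : E, gammaInftyNorm (T.orbit x) ≤ ENNReal.ofReal (M * ‖x‖)) →
          spectralBound T.generator ≤ ((-1 / (4 * (C * M) ^ 2) : ℝ) : EReal) := by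
  refine ⟨halfPlaneConst, halfPlaneConst_pos, ?_, ?_⟩
  · intro E _ _ _ F _ _ _ Θ K δ hK hδ hΘ
    exact isRBoundedWith_laplaceTransform Θ hK hδ hΘ
  intro E _ _ _ T hT
  have hC := halfPlaneConst_pos
  obtain ⟨Θ, hΘ⟩ := exists_pettis_map hT
  have hw := fun x => (hT x).2.1
  have hfin : ∀ x, almostSummingNorm (Θ x) < ∞ := fun x => by
    obtain ⟨R, hR, hRfin⟩ := (hT x).2.2
    rwa [(hΘ x).unique hR]
  obtain ⟨M₀, hM₀, hM₀Θ⟩ := exists_almostSummingNorm_le Θ hfin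
  have hr : 0 < 1 / (4 * (halfPlaneConst * M₀) ^ 2) := by positivity
  -- Halved because the extension holds only strictly short of the critical value.
  set ε := 1 / (4 * (halfPlaneConst * M₀) ^ 2) / 2 with hε
  have hε0 : 0 < ε := by positivity
  obtain ⟨hsub, hR⟩ := resolvent_extension hw hΘ hM₀ hM₀Θ hε0.le (half_lt_self hr)
  refine ⟨?_, ⟨ε, hε0, hsub, hR⟩, ⟨M₀, hM₀.le, fun x => ?_⟩, fun M hM hMT => ?_⟩
  · have hss : {z : ℂ | -ε < z.re} ⊆ {z : ℂ | -ε ≤ z.re} :=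
      fun z (hz : -ε < z.re) => show -ε ≤ z.re from hz.le
    have hss' : IsRBounded (pmapResolvent T.generator '' {z : ℂ | -ε < z.re}) := by
      obtain ⟨B, hB0, hB⟩ := hR
      exact ⟨B, hB0, fun N S x hS => hB N S x fun n => Set.image_mono hss (hS n)⟩
    have hle : rBoundednessAbscissa T.generator ≤ ((-ε : ℝ) : EReal) :=
      iInf₂_le (-ε) ⟨hss.trans hsub, hss'⟩
    refine hle.trans_lt ?_
    exact_mod_cast neg_neg_of_pos hε0
  · rw [gammaInftyNorm_eq (hΘ x)]
    exact hM₀Θ x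
  · rcases hM.eq_or_lt with h0 | hMpos
    -- For M = 0 the division by zero makes the claimed bound 0, which follows from the half-plane
    -- already obtained.
    · subst h0
      have hle : spectralBound T.generator ≤ ((0 : ℝ) : EReal) :=
        spectralBound_le fun ε' hε' z (hz : -ε' ≤ z.re) => hsub (show -ε ≤ z.re by linarith)
      simpa using hle
    · refine spectralBound_le fun ε' hε' => ?_
      rw [neg_div] at hε'
      have hMΘ : ∀ x, almostSummingNorm (Θ x) ≤ ENNReal.ofReal (M * ‖x‖) := fun x =>
        gammaInftyNorm_eq (hΘ x) ▸ hMT x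
      intro z (hz : -ε' ≤ z.re)
      have hr' : 0 < 1 / (4 * (halfPlaneConst * M) ^ 2) := by positivity
      -- ε' may be negative, while the extension requires a nonnegative parameter.
      refine (resolvent_extension hw hΘ hMpos hMΘ (ε := max ε' 0) (le_max_right _ _)
        (max_lt (by linarith) hr')).1 (show -max ε' 0 ≤ z.re from ?_)
      linarith [le_max_left ε' 0]
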